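/- Let $n$ be a positive integer, let $dV$ be Lebesgue measure on $\mathbb{C}^n$ normalized so that $\int_{\mathbb{C}^n} e^{-|z|^2}\,dV(z)=1$, and for $\alpha\in\mathbb{R}$ put $dV_\alpha(z)=(1+|z|)^{-\alpha}\,dV(z)$. For $0<p<\infty$ let $L^p_\alpha$ be the space of Lebesgue measurable $\psi:\mathbb{C}^n\to\mathbb{C}$ for which $$\|\psi\|_{L^p_\alpha}=\Big\{\int_{\mathbb{C}^n}\big|\psi(z)e^{-|z|^2/2}\big|^p\,dV_\alpha(z)\Big\}^{1/p}$$ is finite, and let $L^\infty_\alpha$ be the space of those for which $\|\psi\|_{L^\infty_\alpha}=\operatorname{ess\,sup}_{z}\,|\psi(z)|e^{-|z|^2/2}(1+|z|)^{-\alpha}$ is finite. Let $H(\mathbb{C}^n)$ be the space of entire functions on $\mathbb{C}^n$. For a positive integer $m$ and $f\in H(\mathbb{C}^n)$ with homogeneous expansion $f=\sum_{k\ge 0}f_k$ (where $f_k$ is a homogeneous polynomial of degree $k$), put $$\mathcal{R}^m f(z)=\frac{1}{(1+|z|)^m}\sum_{k=0}^\infty\frac{\Gamma(n+m+k)}{\Gamma(n+k)}f_k(z),\qquad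 \|f\|_{F^p_{\alpha,m}}=\|\mathcal{R}^m f\|_{L^p_\alpha},$$ and let $F^p_{\alpha,m}$ be the space of all $f\in H(\mathbb{C}^n)$ with $\mathcal{R}^m f\in L^p_\alpha$. For a multi-index $\gamma=(\gamma_1,\dots,\gamma_n)$ of nonnegative integers write $|\gamma|=\sum_j\gamma_j$ and $\partial^\gamma=\partial_1^{\gamma_1}\cdots\partial_n^{\gamma_n}$ with $\partial_j=\partial/\partial z_j$. **Corollary 4.4.** Given $0<p\le\infty$, a positive integer $m$ and $\alpha$ real, there is a constant $C=C(n,p,m,\alpha)>0$ such that $$C^{-1}\|f\|_{F^p_{\alpha,m}}\le\sum_{|\gamma|\le m}\|\partial^\gamma f\|_{L^p_\alpha}\le C\|f\|_{F^p_{\alpha,m}}$$ for all $f\in H(\mathbb{C}^n)$, where the quantities may take the value $+\infty$. Moreover, $F^p_{\alpha,m}$ is the space of all $f\in H(\mathbb{C}^n)$ such that $\partial^\gamma f\in L^p_\alpha$ for every multi-index $\gamma$ with $|\gamma|\le m$. -/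

import Mathlib

open MeasureTheory
open scoped ENNReal NNReal

noncomputable section

namespace FockSobolev

/-- Complex `n`-space with its Hermitian norm `|z| = (∑ |z_j|²)^{1/2}`. -/
abbrev CSpace (n : ℕ) : Type := EuclideanSpace ℂ (Fin n)

/-! ### Multi-indices and holomorphic partial derivatives -/

/-- `∂_j f = ∂f/∂z_j`. -/
def partialD {n : ℕ} (j : Fin n) (f : CSpace n → ℂ) : CSpace n → ℂ :=
  fun z => fderiv ℂ f z (EuclideanSpace.single j 1)

/-- `∂^γ f = ∂_1^{γ_1} ⋯ ∂_n^{γ_n} f`. -/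
def multiD {n : ℕ} (γ : Fin n → ℕ) (f : CSpace n → ℂ) : CSpace n → ℂ :=
  (List.finRange n).foldr (fun j g => (partialD j)^[γ j] g) f

/-- The finite set of multi-indices `γ` with `|γ| = k`. -/
def multiIndexEq (n k : ℕ) : Finset (Fin n → ℕ) :=
  (Fintype.piFinset fun _ : Fin n => Finset.range (k + 1)).filter fun γ => ∑ j, γ j = k

/-- The finite set of multi-indices `γ` with `|γ| ≤ m`. -/
def multiIndexLE (n m : ℕ) : Finset (Fin n → ℕ) :=
  (Fintype.piFinset fun _ : Fin n => Finset.range (m + 1)).filter fun γ => ∑ j, γ j ≤ m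

theorem mem_multiIndexEq {n k : ℕ} {γ : Fin n → ℕ} :
    γ ∈ multiIndexEq n k ↔ ∑ j, γ j = k := by
  simp only [multiIndexEq, Finset.mem_filter, Fintype.mem_piFinset, Finset.mem_range,
    and_iff_right_iff_imp]
  intro h j
  have := Finset.single_le_sum (f := γ) (fun i _ => Nat.zero_le _) (Finset.mem_univ j)
  omega

theorem mem_multiIndexLE {n m : ℕ} {γ : Fin n → ℕ} :
    γ ∈ multiIndexLE n m ↔ ∑ j, γ j ≤ m := by
  simp only [multiIndexLE, Finset.mem_filter, Fintype.mem_piFinset, Finset.mem_range,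
    and_iff_right_iff_imp]
  intro h j
  have := Finset.single_le_sum (f := γ) (fun i _ => Nat.zero_le _) (Finset.mem_univ j)
  omega

/-! ### Homogeneous expansion and fractional differentiation -/

/-- The term `f_k` of degree `k` in the homogeneous expansion `f = ∑ f_k` of an entire function:
`f_k(z) = ∑_{|ν| = k} (∂^ν f(0) / ν!) z^ν`. -/
def homogPart {n : ℕ} (f : CSpace n → ℂ) (k : ℕ) : CSpace n → ℂ :=
  fun z => ∑ ν ∈ multiIndexEq n k,
    multiD ν f 0 / ((∏ j, (ν j).factorial : ℕ) : ℂ) * ∏ j, z j ^ ν j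

/-- The Taylor polynomial `f_s^-` of `f`, of degree at most `|s|`. -/
def taylorHead {n : ℕ} (s : ℝ) (f : CSpace n → ℂ) : CSpace n → ℂ :=
  fun z => ∑ k ∈ Finset.range (⌊|s|⌋₊ + 1), homogPart f k z

/-- The fractional derivative `𝒟^s f`: the sum of `Γ(n+s+k) / Γ(n+k) • f_k` over all `k ≥ 0` if
`s ≥ 0`, and over all `k > |s|` if `s < 0`. -/
def fracD {n : ℕ} (s : ℝ) (f : CSpace n → ℂ) : CSpace n → ℂ :=
  fun z => ∑' k : ℕ,
    if 0 ≤ s ∨ |s| < (k : ℝ) then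
      ((Real.Gamma (n + s + k) / Real.Gamma (n + k) : ℝ) : ℂ) * homogPart f k z
    else 0

/-- The fractional radial derivative `ℛ^s f(z) = (1 + |z|)^{-s} 𝒟^s f(z)`. -/
def radialD {n : ℕ} (s : ℝ) (f : CSpace n → ℂ) : CSpace n → ℂ :=
  fun z => (((1 + ‖z‖) ^ (-s) : ℝ) : ℂ) * fracD s f z

/-! ### The weighted Lebesgue spaces `L^p_α` -/

/-- The volume measure `dV` on `ℂⁿ`, normalized so that `∫ e^{-|z|²} dV = 1`. -/
def volV (n : ℕ) : Measure (CSpace n) :=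
  ENNReal.ofReal ((Real.pi ^ n)⁻¹) • volume

theorem integral_exp_neg_norm_sq_volV (n : ℕ) :
    ∫ z, Real.exp (-‖z‖ ^ 2) ∂(volV n) = 1 := by
  have h := GaussianFourier.integral_rexp_neg_mul_sq_norm (V := CSpace n) (b := 1) one_pos
  have hr : Module.finrank ℝ (CSpace n) = 2 * n := by
    rw [← Module.finrank_mul_finrank ℝ ℂ (CSpace n)]
    simp [Complex.finrank_real_complex]
  have hc : (((2 * n : ℕ) : ℝ) / 2) = n := by push_cast; ring
  rw [hr, hc, div_one, Real.rpow_natCast] at h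
  have hpos : (0 : ℝ) < Real.pi ^ n := by positivity
  simp only [neg_mul, one_mul] at h
  rw [volV, integral_smul_measure, h, ENNReal.toReal_ofReal (by positivity), smul_eq_mul,
    inv_mul_cancel₀ hpos.ne']

/-- `dV_α(z) = dV(z) / (1 + |z|)^α`. -/
def volW (n : ℕ) (α : ℝ) : Measure (CSpace n) :=
  (volV n).withDensity fun z => ENNReal.ofReal (1 / (1 + ‖z‖) ^ α)

/-- The `L^p_α` "norm", with values in `[0, ∞]`: for `0 < p < ∞` it is
`(∫ |ψ(z) e^{-|z|²/2}|^p dV_α(z))^{1/p}`, and for `p = ∞` it is the essential supremum of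
`|ψ(z)| e^{-|z|²/2} / (1 + |z|)^α`. -/
def weightedNorm {n : ℕ} (p : ℝ≥0∞) (α : ℝ) (ψ : CSpace n → ℂ) : ℝ≥0∞ :=
  if p = ∞ then
    essSup (fun z => ENNReal.ofReal (‖ψ z‖ * Real.exp (-‖z‖ ^ 2 / 2) / (1 + ‖z‖) ^ α)) (volV n)
  else
    (∫⁻ z, ENNReal.ofReal (‖ψ z‖ * Real.exp (-‖z‖ ^ 2 / 2)) ^ p.toReal ∂(volW n α))
      ^ (1 / p.toReal)

/-- `ψ ∈ L^p_α`: `ψ` is Lebesgue measurable and its norm is finite. -/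
def MemL {n : ℕ} (p : ℝ≥0∞) (α : ℝ) (ψ : CSpace n → ℂ) : Prop :=
  AEStronglyMeasurable ψ (volV n) ∧ weightedNorm p α ψ < ∞

/-! ### The weighted Fock-Sobolev spaces `F^p_{α,s}` -/

/-- The space `F^p_{α,s}` of all entire `f` on `ℂⁿ` with `ℛ^s f ∈ L^p_α`. -/
def fockSobolev (n : ℕ) (p : ℝ≥0∞) (α s : ℝ) : Set (CSpace n → ℂ) :=
  {f | Differentiable ℂ f ∧ MemL p α (radialD s f)}

/-- The norm of `F^p_{α,s}`, with values in `[0, ∞]`. -/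
def fockSobolevNorm {n : ℕ} (p : ℝ≥0∞) (α s : ℝ) (f : CSpace n → ℂ) : ℝ≥0∞ :=
  if 0 ≤ s then weightedNorm p α (radialD s f)
  else weightedNorm p α (radialD s f) + weightedNorm p α (taylorHead s f)

end FockSobolev

end

open MeasureTheory
open scoped ENNReal NNReal

noncomputable section

namespace FockSobolev

/-! ### Partial derivatives of entire functions -/

/-! Everything is measured by `wNorm p s`, the `L^p` norm of `|g| e^{-|z|²/2} (1+|z|)^s`; up to a
constant, `weightedNorm p α` is `wNorm p (weightExp p α)`. Write `R = ∑ z_j ∂_j`. Since `R`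
multiplies `f_k` by `k`, the Gamma quotient makes `fracD m f` equal to `(R+n)(R+n+1)⋯(R+n+m-1) f`
(`fracD_natCast`), so `radialD m f` is this product divided by `(1+|z|)^m`.

Bounding `radialD` by derivatives is pointwise: each factor `R+a` costs one derivative and one power
of `1+|z|`, and the division removes the powers.

The converse balances two estimates. A derivative costs one power: `‖∂_j f‖_s ≤ C ‖f‖_{s+1}`
(`exists_wNorm_partialD_le`), by Cauchy's estimate at radius `1/(1+|z|)`, the scale on which
`e^{-|z|²/2}` is essentially constant. Inverting `R+a` gains two powers: `‖f‖_{s+2} ≤ C ‖(R+a)f‖_s`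
(`exists_wNorm_le_eulerD`), because `f(z) = ∫_0^1 t^{a-1} ((R+a)f)(tz) dt` and the Gaussian confines
the integral to `1-t ≲ (1+|z|)^{-2}`. Hence, for `|γ| ≤ m`, `‖∂^γ f‖_s ≲ ‖f‖_{s+m} ≲
‖(R+n)⋯(R+n+m-1)f‖_{s-m} = ‖radialD m f‖_s`.

To pass from pointwise to `L^p` bounds for every `p > 0`, `exists_local_majorant` dominates local
suprema by a function of comparable norm; it rests on the sub-mean value property of `|F|^p`. -/

theorem differentiable_comp_line {n : ℕ} {f : CSpace n → ℂ} (hf : Differentiable ℂ f)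
    (x v : CSpace n) : Differentiable ℂ fun t : ℂ => f (x + t • v) :=
  hf.comp (by fun_prop)

theorem deriv_comp_line {n : ℕ} {f : CSpace n → ℂ} (hf : Differentiable ℂ f)
    (x v : CSpace n) (t : ℂ) : HasDerivAt (fun t : ℂ => f (x + t • v))
      (fderiv ℂ f (x + t • v) v) t := by
  have h1 : HasDerivAt (fun t : ℂ => x + t • v) v t := by
    simpa using ((hasDerivAt_id t).smul_const v).const_add x
  exact (hf (x + t • v)).hasFDerivAt.comp_hasDerivAt t h1

/-- Cauchy's estimate for directional derivatives. -/
theorem norm_fderiv_apply_le {n : ℕ} {f : CSpace n → ℂ} (hf : Differentiable ℂ f)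
    {x v : CSpace n} {r B : ℝ} (hr : 0 < r)
    (hB : ∀ y ∈ Metric.closedBall x (r * ‖v‖), ‖f y‖ ≤ B) :
    ‖fderiv ℂ f x v‖ ≤ B / r := by
  have h := Complex.norm_deriv_le_of_forall_mem_sphere_norm_le (c := 0) (C := B) hr
    (differentiable_comp_line hf x v).diffContOnCl (fun t ht => hB _ (by
      have : ‖t‖ = r := by simpa using ht
      simp [norm_smul, this]))
  rw [(deriv_comp_line hf x v 0).deriv] at h
  simpa using h

theorem norm_fderiv_le {n : ℕ} {f : CSpace n → ℂ} (hf : Differentiable ℂ f)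
    {x : CSpace n} {B : ℝ} (hB : ∀ y ∈ Metric.closedBall x 1, ‖f y‖ ≤ B) :
    ‖fderiv ℂ f x‖ ≤ B := by
  have hB0 : 0 ≤ B := (norm_nonneg _).trans (hB x (by simp))
  refine ContinuousLinearMap.opNorm_le_of_unit_norm (𝕜 := ℂ) hB0 fun v hv => ?_
  simpa using norm_fderiv_apply_le hf (x := x) (v := v) (r := 1) (B := B) one_pos
    (by simpa [hv] using hB)

/-- Cauchy's formula on the unit circle in direction `v` writes the derivative as an integral of
values of `f`, which is then differentiated under the integral sign. -/
theorem differentiable_fderiv_apply {n : ℕ} {f : CSpace n → ℂ} (hf : Differentiable ℂ f)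
    (v : CSpace n) : Differentiable ℂ fun z => fderiv ℂ f z v := by
  have key : (fun z => fderiv ℂ f z v) = fun z => (2 * Real.pi * Complex.I : ℂ)⁻¹ •
      ∫ θ in (0 : ℝ)..2 * Real.pi, deriv (circleMap 0 1) θ •
        (((circleMap 0 1 θ : ℂ) ^ 2)⁻¹ • f (z + circleMap 0 1 θ • v)) := by
    ext z
    have h := Complex.cderiv_eq_deriv isOpen_univ
      (differentiable_comp_line hf z v).differentiableOn one_pos
      (Set.subset_univ (Metric.closedBall (0 : ℂ) 1))
    rw [(deriv_comp_line hf z v 0).deriv] at h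
    simpa [Complex.cderiv, circleIntegral] using h.symm
  rw [key]
  intro x
  suffices h : DifferentiableAt ℂ (fun z : CSpace n => ∫ θ in (0 : ℝ)..2 * Real.pi,
      deriv (circleMap 0 1) θ • (((circleMap 0 1 θ : ℂ) ^ 2)⁻¹ • f (z + circleMap 0 1 θ • v))) x from
    h.fun_const_smul _
  -- The radius allows 1 for moving `y`, `‖v‖` for the circle, and 1 for the ball in Cauchy's
  -- estimate.
  obtain ⟨B, hB⟩ := (isCompact_closedBall x (2 + ‖v‖)).exists_bound_of_continuousOn
    hf.continuous.continuousOn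
  have hcm : Continuous (circleMap 0 1) := continuous_circleMap 0 1
  have hne : ∀ θ, (circleMap 0 1 θ : ℂ) ^ 2 ≠ 0 := fun θ =>
    pow_ne_zero _ (circleMap_ne_center (c := 0) one_ne_zero)
  have hc : Continuous fun θ => deriv (circleMap 0 1) θ * ((circleMap 0 1 θ : ℂ) ^ 2)⁻¹ := by
    have : Continuous fun θ => ((circleMap 0 1 θ : ℂ) ^ 2)⁻¹ := (hcm.pow 2).inv₀ hne
    simp only [deriv_circleMap]
    fun_prop
  simp_rw [intervalIntegral.integral_of_le Real.two_pi_pos.le, smul_smul]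
  have hbd : ∀ θ, ∀ y ∈ Metric.ball x 1,
      ‖(deriv (circleMap 0 1) θ * ((circleMap 0 1 θ : ℂ) ^ 2)⁻¹) •
        fderiv ℂ f (y + circleMap 0 1 θ • v)‖ ≤ B := by
    intro θ y hy
    rw [norm_smul]
    have h1 : ‖deriv (circleMap 0 1) θ * ((circleMap 0 1 θ : ℂ) ^ 2)⁻¹‖ = 1 := by simp
    rw [h1, one_mul]
    refine norm_fderiv_le hf fun w hw => hB w ?_
    rw [mem_closedBall_iff_norm] at hw ⊢
    rw [mem_ball_iff_norm] at hy
    have h2 : ‖circleMap 0 1 θ • v‖ = ‖v‖ := by simp [norm_smul]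
    have h3 : w - x = (w - (y + circleMap 0 1 θ • v)) + (y - x) + circleMap 0 1 θ • v := by abel
    rw [h3]
    refine (norm_add₃_le).trans ?_
    linarith
  refine (hasFDerivAt_integral_of_dominated_of_fderiv_le (𝕜 := ℂ)
    (F' := fun y θ => (deriv (circleMap 0 1) θ * ((circleMap 0 1 θ : ℂ) ^ 2)⁻¹) •
        fderiv ℂ f (y + circleMap 0 1 θ • v)) (bound := fun _ => B)
    (Metric.ball_mem_nhds x one_pos) ?_ ?_ ?_ ?_ ?_ ?_).differentiableAt
  · refine Filter.Eventually.of_forall fun y => Continuous.aestronglyMeasurable ?_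
    exact hc.smul (hf.continuous.comp (by fun_prop))
  · have : Continuous fun θ => (deriv (circleMap 0 1) θ * ((circleMap 0 1 θ : ℂ) ^ 2)⁻¹) •
      f (x + circleMap 0 1 θ • v) := hc.smul (hf.continuous.comp (by fun_prop))
    exact (this.integrableOn_Icc).mono_set Set.Ioc_subset_Icc_self
  · refine hc.aestronglyMeasurable.smul (Measurable.aestronglyMeasurable ?_)
    exact (measurable_fderiv ℂ f).comp (by fun_prop : Continuous _).measurable
  · exact Filter.Eventually.of_forall fun θ y hy => hbd θ y hy
  · exact integrable_const _
  · refine Filter.Eventually.of_forall fun θ y _ => ?_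
    have h1 : HasFDerivAt (fun y => f (y + circleMap 0 1 θ • v))
        (fderiv ℂ f (y + circleMap 0 1 θ • v)) y :=
      (hf _).hasFDerivAt.comp y ((hasFDerivAt_id y).add_const _)
    exact h1.fun_const_smul _

theorem differentiable_partialD {n : ℕ} {f : CSpace n → ℂ} (hf : Differentiable ℂ f) (j : Fin n) :
    Differentiable ℂ (partialD j f) :=
  differentiable_fderiv_apply hf _

theorem fderiv_eq_sum {n : ℕ} (f : CSpace n → ℂ) (z v : CSpace n) :
    fderiv ℂ f z v = ∑ j, v j * partialD j f z := by
  conv_lhs => rw [← (EuclideanSpace.basisFun (Fin n) ℂ).sum_repr v]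
  simp [partialD]

theorem differentiable_fderiv {n : ℕ} {f : CSpace n → ℂ} (hf : Differentiable ℂ f) :
    Differentiable ℂ (fderiv ℂ f) := by
  have : fderiv ℂ f = fun z => ∑ j, partialD j f z • (EuclideanSpace.proj j : CSpace n →L[ℂ] ℂ) := by
    ext z v
    simp [fderiv_eq_sum, mul_comm]
  rw [this]
  exact Differentiable.fun_sum fun j _ => (differentiable_partialD hf j).smul_const _

theorem partialD_comm {n : ℕ} {f : CSpace n → ℂ} (hf : Differentiable ℂ f) (i j : Fin n) :
    partialD i (partialD j f) = partialD j (partialD i f) := by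
  have h : ∀ (z v w : CSpace n), fderiv ℂ (fun z => fderiv ℂ f z v) z w =
      fderiv ℂ (fderiv ℂ f) z w v := by
    intro z v w
    have := ((differentiable_fderiv hf z).hasFDerivAt.clm_apply
      (hasFDerivAt_const v z)).fderiv
    rw [this]
    simp
  ext z
  change fderiv ℂ (fun z => fderiv ℂ f z _) z _ = fderiv ℂ (fun z => fderiv ℂ f z _) z _
  rw [h, h]
  exact second_derivative_symmetric (fun y => (hf y).hasFDerivAt)
    (differentiable_fderiv hf z).hasFDerivAt _ _

theorem differentiable_partialD_iterate {n : ℕ} {f : CSpace n → ℂ} (hf : Differentiable ℂ f)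
    (j : Fin n) (k : ℕ) : Differentiable ℂ ((partialD j)^[k] f) := by
  induction k with
  | zero => exact hf
  | succ k ih => rw [Function.iterate_succ_apply']; exact differentiable_partialD ih j

/-- Iterated partial derivatives along a list of coordinates. -/
def listD {n : ℕ} (l : List (Fin n)) (γ : Fin n → ℕ) (f : CSpace n → ℂ) : CSpace n → ℂ :=
  l.foldr (fun j g => (partialD j)^[γ j] g) f

theorem differentiable_listD {n : ℕ} {f : CSpace n → ℂ} (hf : Differentiable ℂ f)
    (l : List (Fin n)) (γ : Fin n → ℕ) : Differentiable ℂ (listD l γ f) := by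
  induction l with
  | nil => exact hf
  | cons j l ih => exact differentiable_partialD_iterate ih j _

theorem differentiable_multiD {n : ℕ} {f : CSpace n → ℂ} (hf : Differentiable ℂ f)
    (γ : Fin n → ℕ) : Differentiable ℂ (multiD γ f) :=
  differentiable_listD hf _ γ

theorem partialD_comm_iterate {n : ℕ} {f : CSpace n → ℂ} (hf : Differentiable ℂ f) (i j : Fin n)
    (k : ℕ) : partialD i ((partialD j)^[k] f) = (partialD j)^[k] (partialD i f) := by
  induction k with
  | zero => rfl
  | succ k ih =>
    rw [Function.iterate_succ_apply', Function.iterate_succ_apply', ← ih,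
      partialD_comm (differentiable_partialD_iterate hf j k)]

theorem listD_congr {n : ℕ} {f : CSpace n → ℂ} {l : List (Fin n)} {γ δ : Fin n → ℕ}
    (h : ∀ j ∈ l, γ j = δ j) : listD l γ f = listD l δ f := by
  induction l with
  | nil => rfl
  | cons j l ih =>
    have := ih fun i hi => h i (List.mem_cons_of_mem _ hi)
    simp only [listD, List.foldr_cons] at this ⊢
    rw [this, h j List.mem_cons_self]

/-- Partial derivatives commute, so `∂_i` can be moved to its own slot; `Nodup` makes that slot
unique. -/
theorem partialD_listD {n : ℕ} {f : CSpace n → ℂ} (hf : Differentiable ℂ f) {l : List (Fin n)}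
    (hl : l.Nodup) (γ : Fin n → ℕ) {i : Fin n} (hi : i ∈ l) :
    partialD i (listD l γ f) = listD l (γ + Pi.single i 1) f := by
  induction l with
  | nil => simp at hi
  | cons j l ih =>
    rw [List.nodup_cons] at hl
    change partialD i ((partialD j)^[γ j] (listD l γ f)) =
      (partialD j)^[(γ + Pi.single i 1 : Fin n → ℕ) j] (listD l (γ + Pi.single i 1) f)
    by_cases hij : i = j
    · subst hij
      rw [listD_congr (γ := γ + Pi.single i 1) (δ := γ)]
      · simp [Function.iterate_succ_apply']
      · intro j hj
        have : j ≠ i := fun h => hl.1 (h ▸ hj)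
        simp [this]
    · rw [partialD_comm_iterate (differentiable_listD hf l γ),
        ih hl.2 (by simpa [hij] using hi)]
      simp [Ne.symm hij]

theorem partialD_multiD {n : ℕ} {f : CSpace n → ℂ} (hf : Differentiable ℂ f) (γ : Fin n → ℕ)
    (i : Fin n) : partialD i (multiD γ f) = multiD (γ + Pi.single i 1) f :=
  partialD_listD hf (List.nodup_finRange n) γ (List.mem_finRange i)

theorem multiD_zero {n : ℕ} (f : CSpace n → ℂ) : multiD (0 : Fin n → ℕ) f = f := by
  simp [multiD]

/-! ### The operators `R + a` with `R` the radial derivative -/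

/-- The shifted Euler operator `f ↦ ∑ z_j ∂_j f + a f`. -/
def eulerD {n : ℕ} (a : ℕ) (f : CSpace n → ℂ) : CSpace n → ℂ :=
  fun z => ∑ j, z j * partialD j f z + a * f z

theorem differentiable_eulerD {n : ℕ} {f : CSpace n → ℂ} (hf : Differentiable ℂ f) (a : ℕ) :
    Differentiable ℂ (eulerD a f) := by
  refine Differentiable.add (Differentiable.fun_sum fun j _ => ?_) (hf.const_mul _)
  exact Differentiable.mul (by fun_prop) (differentiable_partialD hf j)

/-- The commutator of `∂_i` with `R` is `∂_i`, which raises the shift by one. -/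
theorem partialD_eulerD {n : ℕ} {f : CSpace n → ℂ} (hf : Differentiable ℂ f) (a : ℕ) (i : Fin n) :
    partialD i (eulerD a f) = eulerD (a + 1) (partialD i f) := by
  ext z
  have hz : ∀ j, HasFDerivAt (fun z : CSpace n => z j)
      (EuclideanSpace.proj j : CSpace n →L[ℂ] ℂ) z := fun j =>
    (EuclideanSpace.proj j : CSpace n →L[ℂ] ℂ).hasFDerivAt
  have h := (HasFDerivAt.fun_sum (u := Finset.univ) fun j _ =>
    (hz j).mul (differentiable_partialD hf j z).hasFDerivAt).add ((hf z).hasFDerivAt.const_mul (a : ℂ))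
  have h' : HasFDerivAt (eulerD a f) _ z := h
  rw [partialD, h'.fderiv]
  simp only [add_apply, sum_apply, smul_apply, smul_eq_mul, eulerD]
  have h2 : ∀ j, fderiv ℂ (partialD j f) z (EuclideanSpace.single i 1) =
      partialD j (partialD i f) z := fun j => congrFun (partialD_comm hf i j) z
  simp only [h2, Finset.sum_add_distrib]
  simp [partialD]
  ring

theorem partialD_iterate_eulerD {n : ℕ} {f : CSpace n → ℂ} (hf : Differentiable ℂ f) (a k : ℕ)
    (i : Fin n) : (partialD i)^[k] (eulerD a f) = eulerD (a + k) ((partialD i)^[k] f) := by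
  induction k with
  | zero => rfl
  | succ k ih =>
    rw [Function.iterate_succ_apply', ih, Function.iterate_succ_apply',
      partialD_eulerD (differentiable_partialD_iterate hf i k)]
    rfl

theorem listD_eulerD {n : ℕ} {f : CSpace n → ℂ} (hf : Differentiable ℂ f) (a : ℕ)
    (l : List (Fin n)) (γ : Fin n → ℕ) :
    listD l γ (eulerD a f) = eulerD (a + (l.map γ).sum) (listD l γ f) := by
  induction l with
  | nil => rfl
  | cons j l ih =>
    change (partialD j)^[γ j] (listD l γ (eulerD a f)) =
      eulerD _ ((partialD j)^[γ j] (listD l γ f))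
    rw [ih, partialD_iterate_eulerD (differentiable_listD hf l γ), List.map_cons, List.sum_cons]
    congr 1
    omega

theorem multiD_eulerD {n : ℕ} {f : CSpace n → ℂ} (hf : Differentiable ℂ f) (a : ℕ)
    (γ : Fin n → ℕ) : multiD γ (eulerD a f) = eulerD (a + ∑ j, γ j) (multiD γ f) := by
  have := listD_eulerD hf a (List.finRange n) γ
  rwa [← List.ofFn_eq_map, List.sum_ofFn] at this

/-- The composition of the operators `R + n + i` for `i < k`. -/
def eulerProd {n : ℕ} : ℕ → (CSpace n → ℂ) → CSpace n → ℂ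
  | 0, f => f
  | k + 1, f => eulerProd k (eulerD (n + k) f)

theorem differentiable_eulerProd {n : ℕ} (k : ℕ) {f : CSpace n → ℂ} (hf : Differentiable ℂ f) :
    Differentiable ℂ (eulerProd k f) := by
  induction k generalizing f with
  | zero => exact hf
  | succ k ih => exact ih (differentiable_eulerD hf _)

/-! ### The homogeneous expansion along rays -/

theorem deriv_comp_ray {n : ℕ} {f : CSpace n → ℂ} (hf : Differentiable ℂ f)
    (z : CSpace n) (t : ℂ) :
    HasDerivAt (fun t : ℂ => f (t • z)) (∑ j, z j * partialD j f (t • z)) t := by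
  have := deriv_comp_line hf 0 z t
  simpa [fderiv_eq_sum] using this

theorem differentiable_comp_ray {n : ℕ} {f : CSpace n → ℂ} (hf : Differentiable ℂ f)
    (z : CSpace n) : Differentiable ℂ (fun t : ℂ => f (t • z)) :=
  fun t => (deriv_comp_ray hf z t).differentiableAt

/-- Reindex by `μ = ν + e_j`, using `1/ν! = μ_j/μ!`; the `μ` not reached have `μ_j = 0` and
contribute nothing. -/
theorem sum_multiIndexEq_add_single {n k : ℕ} (F : (Fin n → ℕ) → ℂ) (j : Fin n) :
    ∑ ν ∈ multiIndexEq n k, F (ν + Pi.single j 1) / ((∏ i, (ν i).factorial : ℕ) : ℂ) =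
      ∑ μ ∈ multiIndexEq n (k + 1), (μ j : ℂ) * (F μ / ((∏ i, (μ i).factorial : ℕ) : ℂ)) := by
  refine Finset.sum_of_injOn (fun ν => ν + Pi.single j 1) ?_ ?_ ?_ ?_
  · exact fun a _ b _ h => add_right_cancel h
  · intro ν hν
    simp only [Finset.mem_coe, mem_multiIndexEq] at hν ⊢
    simp [Finset.sum_add_distrib, hν]
  · intro μ hμ hn
    rw [mem_multiIndexEq] at hμ
    have : μ j = 0 := by
      by_contra h0
      refine hn ⟨μ - Pi.single j 1, ?_, ?_⟩
      · rw [Finset.mem_coe, mem_multiIndexEq]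
        have h1 : (μ - Pi.single j 1) + Pi.single j 1 = μ := by
          refine tsub_add_cancel_of_le fun i => ?_
          by_cases hi : i = j
          · subst hi; simp; omega
          · simp [hi]
        have h2 : ∑ i, ((μ - Pi.single j 1) + Pi.single j 1 : Fin n → ℕ) i = k + 1 := by
          rw [h1, hμ]
        simp only [Pi.add_apply, Finset.sum_add_distrib] at h2
        simpa using h2
      · refine tsub_add_cancel_of_le fun i => ?_
        by_cases hi : i = j
        · subst hi; simp; omega
        · simp [hi]
    simp [this]
  · intro ν _
    have h : ∏ i, ((ν + Pi.single j 1 : Fin n → ℕ) i).factorial =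
        (ν j + 1) * ∏ i, (ν i).factorial := by
      rw [← Finset.mul_prod_erase _ _ (Finset.mem_univ j),
        ← Finset.mul_prod_erase Finset.univ (fun i => (ν i).factorial) (Finset.mem_univ j),
        ← mul_assoc]
      congr 1
      · simp [Nat.factorial_succ]
      · refine Finset.prod_congr rfl fun i hi => ?_
        simp [(Finset.mem_erase.1 hi).1]
    rw [h]
    have h1 : ((∏ i, (ν i).factorial : ℕ) : ℂ) ≠ 0 := by
      exact_mod_cast Finset.prod_ne_zero_iff.2 fun i _ => Nat.factorial_ne_zero _
    have h2 : (ν j : ℂ) + 1 ≠ 0 := Nat.cast_add_one_ne_zero (ν j)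
    push_cast at h1 ⊢
    field_simp
    simp

theorem sum_sum_multiIndexEq_add_single {n k : ℕ} (F : (Fin n → ℕ) → ℂ) :
    ∑ ν ∈ multiIndexEq n k, ∑ j, F (ν + Pi.single j 1) / ((∏ i, (ν i).factorial : ℕ) : ℂ) =
      (k + 1) * ∑ μ ∈ multiIndexEq n (k + 1), F μ / ((∏ i, (μ i).factorial : ℕ) : ℂ) := by
  rw [Finset.sum_comm]
  simp_rw [sum_multiIndexEq_add_single]
  rw [Finset.sum_comm, Finset.mul_sum]
  refine Finset.sum_congr rfl fun μ hμ => ?_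
  rw [mem_multiIndexEq] at hμ
  rw [← Finset.sum_mul, ← Nat.cast_sum, hμ]
  push_cast
  rfl

/-- This identifies `homogPart f k z` with the `k`-th Taylor coefficient of `t ↦ f(tz)` at 0, so the
homogeneous expansion converges by one-variable theory. -/
theorem iteratedDeriv_comp_ray {n : ℕ} {f : CSpace n → ℂ} (hf : Differentiable ℂ f)
    (z : CSpace n) (k : ℕ) : iteratedDeriv k (fun t : ℂ => f (t • z)) = fun t =>
      k.factorial * ∑ ν ∈ multiIndexEq n k,
        multiD ν f (t • z) * (∏ j, z j ^ ν j) / ((∏ j, (ν j).factorial : ℕ) : ℂ) := by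
  induction k with
  | zero =>
    have h : multiIndexEq n 0 = {0} := by
      ext ν
      rw [mem_multiIndexEq, Finset.mem_singleton]
      simp [funext_iff]
    ext t
    simp [h, multiD_zero]
  | succ k ih =>
    rw [iteratedDeriv_succ, ih]
    ext t
    have h1 : ∀ ν : Fin n → ℕ, HasDerivAt (fun t : ℂ => multiD ν f (t • z) * (∏ j, z j ^ ν j) /
        ((∏ j, (ν j).factorial : ℕ) : ℂ))
        (∑ j, (multiD (ν + Pi.single j 1) f (t • z) *
          (∏ i, z i ^ (ν + Pi.single j 1 : Fin n → ℕ) i)) /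
          ((∏ j, (ν j).factorial : ℕ) : ℂ)) t := by
      intro ν
      refine (((deriv_comp_ray (differentiable_multiD hf ν) z t).mul_const _).div_const
        _).congr_deriv ?_
      rw [Finset.sum_mul, Finset.sum_div]
      refine Finset.sum_congr rfl fun j _ => ?_
      have h : ∏ i, z i ^ (ν + Pi.single j 1 : Fin n → ℕ) i = z j * ∏ i, z i ^ ν i := by
        simp only [Pi.add_apply, pow_add, Finset.prod_mul_distrib]
        rw [mul_comm, Finset.prod_eq_single j (by simp +contextual) (by simp)]
        simp
      rw [partialD_multiD hf, h]
      ring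
    rw [((HasDerivAt.fun_sum fun ν _ => h1 ν).const_mul _).deriv,
      sum_sum_multiIndexEq_add_single
        (fun μ => multiD μ f (t • z) * (∏ i, z i ^ μ i)), Nat.factorial_succ]
    push_cast
    ring

theorem hasSum_homogPart {n : ℕ} {f : CSpace n → ℂ} (hf : Differentiable ℂ f) (z : CSpace n) :
    HasSum (fun k => homogPart f k z) (f z) := by
  have h := Complex.hasSum_taylorSeries_of_entire (differentiable_comp_ray hf z) 0 1
  rw [one_smul] at h
  refine (congrArg (HasSum · (f z)) (funext fun k => ?_)).mpr h
  rw [iteratedDeriv_comp_ray hf z]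
  have : (k.factorial : ℂ) ≠ 0 := by exact_mod_cast Nat.factorial_ne_zero k
  simp only [sub_zero, one_pow, one_mul, zero_smul, smul_eq_mul, homogPart]
  rw [inv_mul_cancel_left₀ this]
  exact Finset.sum_congr rfl fun ν _ => by ring

/-- No series is differentiated: `∂^ν (R+a) f = (R+a+|ν|) ∂^ν f`, and `R` vanishes at the origin. -/
theorem homogPart_eulerD {n : ℕ} {f : CSpace n → ℂ} (hf : Differentiable ℂ f) (a k : ℕ)
    (z : CSpace n) : homogPart (eulerD a f) k z = (a + k : ℕ) * homogPart f k z := by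
  simp only [homogPart, Finset.mul_sum]
  refine Finset.sum_congr rfl fun ν hν => ?_
  rw [mem_multiIndexEq] at hν
  rw [multiD_eulerD hf, hν]
  simp [eulerD]
  ring

theorem homogPart_eulerProd {n : ℕ} (m : ℕ) {f : CSpace n → ℂ} (hf : Differentiable ℂ f) (k : ℕ)
    (z : CSpace n) :
    homogPart (eulerProd m f) k z = (∏ i ∈ Finset.range m, (n + i + k) : ℕ) * homogPart f k z := by
  induction m generalizing f with
  | zero => simp [eulerProd]
  | succ m ih =>
    rw [eulerProd, ih (differentiable_eulerD hf _), homogPart_eulerD hf, Finset.prod_range_succ]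
    push_cast
    ring

theorem gamma_div_gamma {n : ℕ} (hn : 0 < n) (m k : ℕ) :
    Real.Gamma (n + m + k) / Real.Gamma (n + k) = (∏ i ∈ Finset.range m, (n + i + k) : ℕ) := by
  have hpos : ∀ i : ℕ, (0 : ℝ) < n + i + k := fun i => by positivity
  have h0 : Real.Gamma (n + k) ≠ 0 := (Real.Gamma_pos_of_pos (by positivity)).ne'
  rw [div_eq_iff h0]
  induction m with
  | zero => simp
  | succ m ih =>
    have : ((n : ℝ) + (m + 1 : ℕ) + k) = (n + m + k) + 1 := by push_cast; ring
    rw [this, Real.Gamma_add_one (hpos m).ne', ih, Finset.prod_range_succ]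
    push_cast
    ring

theorem fracD_natCast {n : ℕ} (hn : 0 < n) (m : ℕ) {f : CSpace n → ℂ} (hf : Differentiable ℂ f) :
    fracD (m : ℝ) f = eulerProd m f := by
  ext z
  rw [← (hasSum_homogPart (differentiable_eulerProd m hf) z).tsum_eq, fracD]
  refine tsum_congr fun k => ?_
  rw [if_pos (Or.inl (Nat.cast_nonneg m)), homogPart_eulerProd m hf, gamma_div_gamma hn]
  norm_cast

/-! ### Pointwise control of the Euler operators by partial derivatives -/

theorem norm_eulerD_le {n : ℕ} (a : ℕ) (f : CSpace n → ℂ) (z : CSpace n) :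
    ‖eulerD a f z‖ ≤ (a + 1) * (1 + ‖z‖) * (‖f z‖ + ∑ j, ‖partialD j f z‖) := by
  have hz := norm_nonneg z
  have h1 : ‖∑ j, z j * partialD j f z‖ ≤ ‖z‖ * ∑ j, ‖partialD j f z‖ := by
    rw [Finset.mul_sum]
    refine norm_sum_le_of_le _ fun j _ => ?_
    rw [norm_mul]
    gcongr
    exact PiLp.norm_apply_le z j
  have h2 : 0 ≤ ∑ j, ‖partialD j f z‖ := by positivity
  have h3 : ‖eulerD a f z‖ ≤ ‖z‖ * ∑ j, ‖partialD j f z‖ + a * ‖f z‖ := by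
    refine (norm_add_le _ _).trans (add_le_add h1 ?_)
    simp
  refine h3.trans ?_
  have ha : (0 : ℝ) ≤ a := Nat.cast_nonneg a
  have h4 := norm_nonneg (f z)
  have h5 := mul_nonneg ha hz
  nlinarith [mul_nonneg h5 h4, mul_nonneg h5 h2, mul_nonneg ha h2, mul_nonneg hz h4]

theorem norm_multiD_eulerD_le {n : ℕ} {f : CSpace n → ℂ} (hf : Differentiable ℂ f) {a k : ℕ}
    {γ : Fin n → ℕ} (hγ : γ ∈ multiIndexLE n k) (z : CSpace n) :
    ‖multiD γ (eulerD a f) z‖ ≤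
      (a + k + 1) * (n + 1) * (1 + ‖z‖) * ∑ δ ∈ multiIndexLE n (k + 1), ‖multiD δ f z‖ := by
  rw [mem_multiIndexLE] at hγ
  set S := ∑ δ ∈ multiIndexLE n (k + 1), ‖multiD δ f z‖
  have hS : ∀ δ ∈ multiIndexLE n (k + 1), ‖multiD δ f z‖ ≤ S := fun δ hδ =>
    Finset.single_le_sum (f := fun δ => ‖multiD δ f z‖) (fun _ _ => norm_nonneg _) hδ
  have hS0 : 0 ≤ S := Finset.sum_nonneg fun _ _ => norm_nonneg _
  have h1 : ‖multiD γ f z‖ ≤ S := hS γ (by rw [mem_multiIndexLE]; omega)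
  have h2 : ∑ j, ‖partialD j (multiD γ f) z‖ ≤ n * S := by
    refine (Finset.sum_le_card_nsmul _ _ S fun j _ => ?_).trans (by simp)
    rw [partialD_multiD hf]
    refine hS _ ?_
    rw [mem_multiIndexLE]
    simp [Finset.sum_add_distrib, hγ]
  rw [multiD_eulerD hf]
  refine (norm_eulerD_le _ _ z).trans ?_
  have h3 : (((a + ∑ j, γ j : ℕ) : ℝ) + 1) ≤ a + k + 1 := by
    have : (a + ∑ j, γ j) + 1 ≤ a + k + 1 := by omega
    exact_mod_cast this
  calc _ ≤ (a + k + 1 : ℝ) * (1 + ‖z‖) * (S + n * S) := by gcongr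
    _ = _ := by ring

/-- Each factor `R+a` costs one derivative and one factor `1+|z|`; the power `(1+|z|)^m` is what
`radialD` divides out. -/
theorem exists_norm_eulerProd_le (n m : ℕ) : ∃ C : ℝ, 0 ≤ C ∧ ∀ f : CSpace n → ℂ,
    Differentiable ℂ f → ∀ z, ‖eulerProd m f z‖ ≤
      C * (1 + ‖z‖) ^ m * ∑ γ ∈ multiIndexLE n m, ‖multiD γ f z‖ := by
  induction m with
  | zero =>
    refine ⟨1, zero_le_one, fun f _ z => ?_⟩
    have h : multiIndexLE n 0 = {0} := by
      ext ν
      rw [mem_multiIndexLE, Finset.mem_singleton]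
      simp [funext_iff]
    simp [eulerProd, h, multiD_zero]
  | succ m ih =>
    obtain ⟨C, hC, h⟩ := ih
    refine ⟨C * ((multiIndexLE n m).card * (((n + m : ℕ) + m + 1) * (n + 1))), by positivity,
      fun f hf z => (h _ (differentiable_eulerD hf _) z).trans ?_⟩
    have h1 := Finset.sum_le_card_nsmul (multiIndexLE n m)
      (fun γ => ‖multiD γ (eulerD (n + m) f) z‖) _
      fun γ hγ => norm_multiD_eulerD_le (a := n + m) hf hγ z
    rw [nsmul_eq_mul] at h1
    have hz : (0 : ℝ) ≤ C * (1 + ‖z‖) ^ m := by positivity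
    refine (mul_le_mul_of_nonneg_left h1 hz).trans (le_of_eq ?_)
    ring

/-! ### Local bounds for entire functions by integral means -/

/-- Multiplication by a unimodular scalar is an isometry. With Tonelli, this turns means over
circles into means over balls. -/
theorem setLIntegral_ball_add_unit_smul {n : ℕ} (g : CSpace n → ℝ≥0∞) (z : CSpace n) {c : ℂ}
    (hc : ‖c‖ = 1) (r : ℝ) :
    ∫⁻ u in Metric.ball 0 r, g (z + c • u) = ∫⁻ u in Metric.ball z r, g u := by
  have hc0 : c ≠ 0 := by
    intro h
    simp [h] at hc
  let e : CSpace n ≃ₗᵢ[ℝ] CSpace n :=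
    { toLinearEquiv := (LinearEquiv.smulOfNeZero ℂ (CSpace n) c hc0).restrictScalars ℝ
      norm_map' := fun u => by simp [norm_smul, hc] }
  have h1 : MeasurePreserving (fun u : CSpace n => c • u) :=
    LinearIsometryEquiv.measurePreserving e
  have h2 : MeasurePreserving (fun u : CSpace n => z + c • u) :=
    (measurePreserving_add_left volume z).comp h1
  have he : MeasurableEmbedding (fun u : CSpace n => z + c • u) :=
    (measurableEmbedding_addLeft z).comp (e.toHomeomorph.measurableEmbedding)
  rw [← h2.setLIntegral_comp_preimage_emb he g (Metric.ball z r)]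
  congr 2
  ext u
  simp [norm_smul, hc]

theorem enorm_mul_le_lintegral_circle {n : ℕ} {F : CSpace n → ℂ} (hF : Differentiable ℂ F)
    (z u : CSpace n) : ENNReal.ofReal (2 * Real.pi) * ‖F z‖ₑ ≤
      ∫⁻ θ in Set.Ioc 0 (2 * Real.pi), ‖F (z + circleMap 0 1 θ • u)‖ₑ := by
  have h := (differentiable_comp_line hF z u).diffContOnCl.circleAverage (c := 0) (R := 1)
  rw [Real.circleAverage_def, intervalIntegral.integral_of_le Real.two_pi_pos.le] at h
  simp only [zero_smul, add_zero] at h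
  rw [← h, enorm_smul, ← mul_assoc]
  have : ENNReal.ofReal (2 * Real.pi) * ‖(2 * Real.pi)⁻¹‖ₑ = 1 := by
    rw [Real.enorm_eq_ofReal (by positivity), ← ENNReal.ofReal_mul (by positivity),
      mul_inv_cancel₀ (by positivity), ENNReal.ofReal_one]
  rw [this, one_mul]
  exact enorm_integral_le_lintegral_enorm _

/-- The sub-mean value property of `|F|` on balls. -/
theorem enorm_mul_volume_ball_le {n : ℕ} {F : CSpace n → ℂ} (hF : Differentiable ℂ F)
    (z : CSpace n) (r : ℝ) :
    ‖F z‖ₑ * volume (Metric.ball z r) ≤ ∫⁻ u in Metric.ball z r, ‖F u‖ₑ := by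
  set c := ENNReal.ofReal (2 * Real.pi)
  have hc0 : c ≠ 0 := by simp [c, Real.pi_pos]
  have hct : c ≠ ∞ := ENNReal.ofReal_ne_top
  have hv : volume (Metric.ball z r) = volume (Metric.ball (0 : CSpace n) r) :=
    Measure.addHaar_ball_center volume z r
  have hcont : Continuous fun q : CSpace n × ℝ => ‖F (z + circleMap 0 1 q.2 • q.1)‖ₑ := by
    have := hF.continuous
    have := continuous_circleMap 0 1
    fun_prop
  refine (ENNReal.mul_le_mul_iff_right hc0 hct).1 ?_
  calc c * (‖F z‖ₑ * volume (Metric.ball z r))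
      = ∫⁻ _u in Metric.ball (0 : CSpace n) r, c * ‖F z‖ₑ := by
        rw [setLIntegral_const, hv, mul_assoc]
    _ ≤ ∫⁻ u in Metric.ball (0 : CSpace n) r, ∫⁻ θ in Set.Ioc 0 (2 * Real.pi),
          ‖F (z + circleMap 0 1 θ • u)‖ₑ :=
        lintegral_mono fun u => enorm_mul_le_lintegral_circle hF z u
    _ = ∫⁻ θ in Set.Ioc 0 (2 * Real.pi), ∫⁻ u in Metric.ball (0 : CSpace n) r,
          ‖F (z + circleMap 0 1 θ • u)‖ₑ :=
        lintegral_lintegral_swap hcont.measurable.aemeasurable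
    _ = ∫⁻ _θ in Set.Ioc 0 (2 * Real.pi), ∫⁻ u in Metric.ball z r, ‖F u‖ₑ := by
        refine lintegral_congr fun θ => ?_
        exact setLIntegral_ball_add_unit_smul (fun u => ‖F u‖ₑ) z (by simp) r
    _ = c * ∫⁻ u in Metric.ball z r, ‖F u‖ₑ := by
        rw [setLIntegral_const, mul_comm]
        simp [c]

theorem volume_unit_ball_pos (n : ℕ) : 0 < (volume (Metric.ball (0 : CSpace n) 1)).toReal :=
  ENNReal.toReal_pos (Metric.measure_ball_pos volume _ one_pos).ne' measure_ball_lt_top.ne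

/-- The sub-mean value property of `|F|^q`, up to a constant, for `q < 1`. -/
theorem exists_enorm_rpow_le_lintegral {n : ℕ} (hn : 0 < n) {q : ℝ} (hq : 0 < q) (hq1 : q < 1) :
    ∃ C : ℝ≥0, ∀ F : CSpace n → ℂ, Differentiable ℂ F → ∀ z₀,
      ‖F z₀‖ₑ ^ q ≤ C * ∫⁻ u in Metric.ball z₀ 1, ‖F u‖ₑ ^ q := by
  set v := (volume (Metric.ball (0 : CSpace n) 1)).toReal with hv
  have hv0 : 0 < v := volume_unit_ball_pos n
  set d := Module.finrank ℝ (CSpace n)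
  -- The exponent is chosen so that `a q` is the real dimension; the powers of `δ` then cancel at
  -- the end.
  set a : ℝ := d / q with ha
  have haq : a * q = d := by rw [ha]; field_simp
  have ha0 : 0 ≤ a := by positivity
  refine ⟨(2 ^ a / v).toNNReal, fun F hF z₀ => ?_⟩
  have hC0 : (0 : ℝ) < 2 ^ a / v := by positivity
  have hC : (((2 ^ a / v).toNNReal : ℝ≥0) : ℝ≥0∞) = ENNReal.ofReal (2 ^ a / v) := rfl
  rw [hC]
  by_cases hI : ∫⁻ u in Metric.ball z₀ 1, ‖F u‖ₑ ^ q = ∞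
  · rw [hI, ENNReal.mul_top (by simpa using hC0)]
    exact le_top
  set I := ∫⁻ u in Metric.ball z₀ 1, ‖F u‖ₑ ^ q
  have hφ : Continuous fun z => (1 - ‖z - z₀‖) ^ a * ‖F z‖ := by
    have := hF.continuous
    exact ((continuous_const.sub (by fun_prop)).rpow_const fun _ => Or.inr ha0).mul (by fun_prop)
  -- Maximizing `|F|` against a weight vanishing on the boundary gives an interior point `w`, near
  -- which `|F|` is bounded by a multiple of its value there.
  obtain ⟨w, hw, hmax⟩ := (isCompact_closedBall z₀ 1).exists_isMaxOn
    ⟨z₀, by simp⟩ hφ.continuousOn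
  set S := (1 - ‖w - z₀‖) ^ a * ‖F w‖ with hS
  have hSmax : ∀ u ∈ Metric.closedBall z₀ 1, (1 - ‖u - z₀‖) ^ a * ‖F u‖ ≤ S := fun u hu => hmax hu
  have hz₀S : ‖F z₀‖ ≤ S := by simpa using hSmax z₀ (by simp)
  have hS0 : 0 ≤ S := (norm_nonneg _).trans hz₀S
  rw [mem_closedBall_iff_norm] at hw
  suffices hkey : S ^ q ≤ 2 ^ a / v * I.toReal by
    calc ‖F z₀‖ₑ ^ q = ENNReal.ofReal (‖F z₀‖ ^ q) := by
          rw [← ofReal_norm, ENNReal.ofReal_rpow_of_nonneg (norm_nonneg _) hq.le]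
      _ ≤ ENNReal.ofReal (2 ^ a / v * I.toReal) :=
          ENNReal.ofReal_le_ofReal ((Real.rpow_le_rpow (norm_nonneg _) hz₀S hq.le).trans hkey)
      _ = _ := by rw [ENNReal.ofReal_mul hC0.le, ENNReal.ofReal_toReal hI]
  rcases hS0.eq_or_lt with h0 | hSpos
  · rw [← h0, Real.zero_rpow hq.ne']
    positivity
  have hd : 0 < d := by
    have : Nonempty (Fin n) := ⟨⟨0, hn⟩⟩
    exact Module.finrank_pos
  have ha1 : 0 < a := by positivity
  have hw1 : ‖w - z₀‖ < 1 := by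
    refine lt_of_le_of_ne hw fun h => ?_
    rw [hS, h, sub_self, Real.zero_rpow ha1.ne', zero_mul] at hSpos
    exact lt_irrefl _ hSpos
  set δ := (1 - ‖w - z₀‖) / 2 with hδ
  have hδ0 : 0 < δ := by rw [hδ]; linarith
  have hball : Metric.ball w δ ⊆ Metric.ball z₀ 1 := by
    refine Metric.ball_subset_ball' ?_
    rw [dist_eq_norm, hδ]
    linarith
  -- On this ball the weight is at least `δ^a`, so `|F| ≤ S δ^{-a}`; split `|F| = |F|^{1-q} |F|^q`
  -- and bound the first factor.
  have hFu : ∀ u ∈ Metric.ball w δ, ‖F u‖ₑ ≤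
      ENNReal.ofReal ((S * δ ^ (-a)) ^ (1 - q)) * ‖F u‖ₑ ^ q := by
    intro u hu
    have h1 : δ ≤ 1 - ‖u - z₀‖ := by
      have h3 : ‖u - z₀‖ ≤ ‖u - w‖ + ‖w - z₀‖ := norm_sub_le_norm_sub_add_norm_sub u w z₀
      rw [mem_ball_iff_norm] at hu
      rw [hδ] at hu ⊢
      linarith
    have h2 : δ ^ a * ‖F u‖ ≤ S := by
      refine le_trans ?_ (hSmax u (Metric.ball_subset_closedBall (hball hu)))
      gcongr
    have h3 : ‖F u‖ ≤ S * δ ^ (-a) := by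
      rw [Real.rpow_neg hδ0.le, ← div_eq_mul_inv, le_div_iff₀ (by positivity)]
      linarith
    rw [← ofReal_norm, ENNReal.ofReal_rpow_of_nonneg (norm_nonneg _) hq.le,
      ← ENNReal.ofReal_mul (by positivity)]
    refine ENNReal.ofReal_le_ofReal ?_
    rcases (norm_nonneg (F u)).eq_or_lt with h0 | h0
    · rw [← h0]; positivity
    calc ‖F u‖ = ‖F u‖ ^ (1 - q) * ‖F u‖ ^ q := by
          rw [← Real.rpow_add h0]; simp
      _ ≤ _ := by
          gcongr
  have hmean := enorm_mul_volume_ball_le hF w δ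
  have h1 : ∫⁻ u in Metric.ball w δ, ‖F u‖ₑ ≤ ENNReal.ofReal ((S * δ ^ (-a)) ^ (1 - q)) * I :=
    calc _ ≤ ∫⁻ u in Metric.ball w δ, ENNReal.ofReal ((S * δ ^ (-a)) ^ (1 - q)) * ‖F u‖ₑ ^ q :=
          setLIntegral_mono' measurableSet_ball hFu
      _ = ENNReal.ofReal ((S * δ ^ (-a)) ^ (1 - q)) * ∫⁻ u in Metric.ball w δ, ‖F u‖ₑ ^ q :=
          lintegral_const_mul' _ _ ENNReal.ofReal_ne_top
      _ ≤ _ := by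
          gcongr
          exact lintegral_mono_set hball
  have h2 := ENNReal.toReal_mono (ENNReal.mul_ne_top ENNReal.ofReal_ne_top hI) (hmean.trans h1)
  rw [Measure.addHaar_ball_of_pos volume w hδ0, ENNReal.toReal_mul, ENNReal.toReal_mul,
    ENNReal.toReal_mul, ENNReal.toReal_ofReal (by positivity),
    ENNReal.toReal_ofReal (by positivity), ← hv, toReal_enorm] at h2
  have hFw : ‖F w‖ = S * (2 * δ) ^ (-a) := by
    have : 2 * δ = 1 - ‖w - z₀‖ := by rw [hδ]; ring
    rw [this, hS, Real.rpow_neg (by linarith), mul_comm, inv_mul_cancel_left₀]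
    have : 0 < 1 - ‖w - z₀‖ := by linarith
    positivity
  rw [hFw, Real.mul_rpow zero_le_two hδ0.le, Real.mul_rpow hS0 (by positivity),
    ← Real.rpow_mul hδ0.le, Real.rpow_sub hSpos, Real.rpow_one] at h2
  have h3 : δ ^ (-a * (1 - q)) = δ ^ (-a) * δ ^ d := by
    rw [← Real.rpow_natCast, ← Real.rpow_add hδ0]
    congr 1
    linarith
  rw [h3, Real.rpow_neg zero_le_two] at h2
  have h4 : 0 < δ ^ (-a) * δ ^ d * S := by positivity
  have h5 : (0 : ℝ) < 2 ^ a := by positivity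
  have h6 : 0 < S ^ q := by positivity
  rw [div_mul_eq_mul_div, le_div_iff₀ hv0]
  refine le_of_mul_le_mul_left ?_ h4
  have e1 : δ ^ (-a) * δ ^ d * S * (S ^ q * v) =
      (S * ((2 ^ a)⁻¹ * δ ^ (-a)) * (δ ^ d * v)) * (2 ^ a * S ^ q) := by
    field_simp
  have e2 : δ ^ (-a) * δ ^ d * S * (2 ^ a * I.toReal) =
      (S / S ^ q * (δ ^ (-a) * δ ^ d) * I.toReal) * (2 ^ a * S ^ q) := by
    field_simp
  rw [e1, e2]
  exact mul_le_mul_of_nonneg_right h2 (by positivity)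

/-- For `p ≥ 1`, including `∞`, this is the sub-mean value property followed by Hölder on the ball.
-/
theorem exists_enorm_le_eLpNorm_ball {n : ℕ} (hn : 0 < n) {p : ℝ≥0∞} (hp : 0 < p) :
    ∃ C : ℝ≥0, ∀ F : CSpace n → ℂ, Differentiable ℂ F → ∀ z,
      ‖F z‖ₑ ≤ C * eLpNorm F p (volume.restrict (Metric.ball z 1)) := by
  rcases lt_or_ge p 1 with hp1 | hp1
  · have hpt : p ≠ ∞ := (hp1.trans ENNReal.one_lt_top).ne
    have hq : 0 < p.toReal := ENNReal.toReal_pos hp.ne' hpt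
    have hq1 : p.toReal < 1 := by
      have := (ENNReal.toReal_lt_toReal hpt ENNReal.one_ne_top).2 hp1
      simpa using this
    obtain ⟨C, hC⟩ := exists_enorm_rpow_le_lintegral hn hq hq1
    refine ⟨C ^ (1 / p.toReal), fun F hF z => ?_⟩
    rw [eLpNorm_eq_lintegral_rpow_enorm_toReal hp.ne' hpt,
      ENNReal.coe_rpow_of_nonneg _ (by positivity), ← ENNReal.mul_rpow_of_nonneg _ _ (by positivity),
      one_div, ENNReal.le_rpow_inv_iff hq]
    exact hC F hF z
  · set v := volume (Metric.ball (0 : CSpace n) 1)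
    have hv0 : v ≠ 0 := (Metric.measure_ball_pos volume _ one_pos).ne'
    have hvt : v ≠ ∞ := measure_ball_lt_top.ne
    have hct : v⁻¹ * v ^ (1 - 1 / p.toReal) ≠ ∞ :=
      ENNReal.mul_ne_top (ENNReal.inv_ne_top.2 hv0) (ENNReal.rpow_ne_top_of_ne_zero hv0 hvt)
    refine ⟨(v⁻¹ * v ^ (1 - 1 / p.toReal)).toNNReal, fun F hF z => ?_⟩
    rw [ENNReal.coe_toNNReal hct]
    have h1 := enorm_mul_volume_ball_le hF z 1
    have h2 := eLpNorm_le_eLpNorm_mul_rpow_measure_univ (μ := volume.restrict (Metric.ball z 1)) hp1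
      hF.continuous.aestronglyMeasurable
    have hv : volume (Metric.ball z 1) = v := Measure.addHaar_ball_center volume z 1
    rw [eLpNorm_one_eq_lintegral_enorm, Measure.restrict_apply_univ, hv] at h2
    rw [hv] at h1
    calc ‖F z‖ₑ = v⁻¹ * (‖F z‖ₑ * v) := by
          rw [mul_comm, mul_assoc, ENNReal.mul_inv_cancel hv0 hvt, mul_one]
      _ ≤ v⁻¹ * (eLpNorm F p (volume.restrict (Metric.ball z 1)) * v ^ (1 - 1 / p.toReal)) := by
          have h3 := h1.trans h2
          rw [ENNReal.toReal_one, one_div_one] at h3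
          exact mul_le_mul_right h3 _
      _ = _ := by ring

/-! ### Gaussian weights -/

/-- The weighted modulus `|g(z)| e^{-|z|²/2} (1 + |z|)^s`. -/
def wMod {n : ℕ} (s : ℝ) (g : CSpace n → ℂ) (z : CSpace n) : ℝ :=
  ‖g z‖ * Real.exp (-‖z‖ ^ 2 / 2) * (1 + ‖z‖) ^ s

/-- The `L^p` norm of the weighted modulus with respect to Lebesgue measure. -/
def wNorm {n : ℕ} (p : ℝ≥0∞) (s : ℝ) (g : CSpace n → ℂ) : ℝ≥0∞ :=
  eLpNorm (wMod s g) p volume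

theorem wMod_nonneg {n : ℕ} (s : ℝ) (g : CSpace n → ℂ) (z : CSpace n) : 0 ≤ wMod s g z := by
  unfold wMod
  positivity

theorem continuous_wMod {n : ℕ} (s : ℝ) {g : CSpace n → ℂ} (hg : Continuous g) :
    Continuous (wMod s g) := by
  unfold wMod
  refine Continuous.mul (by fun_prop) (Continuous.rpow_const (by fun_prop) fun z => Or.inl ?_)
  positivity

/-- The weights `(1 + |z|)^s` are comparable at points of distance at most `1`. -/
theorem one_add_norm_rpow_le {n : ℕ} (s : ℝ) {z w : CSpace n} (h : ‖z - w‖ ≤ 1) :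
    (1 + ‖z‖) ^ s ≤ 2 ^ |s| * (1 + ‖w‖) ^ s := by
  have hz := norm_nonneg z
  have hw := norm_nonneg w
  have h1 : 1 + ‖z‖ ≤ 2 * (1 + ‖w‖) := by
    have := norm_le_norm_add_norm_sub w z
    rw [norm_sub_rev] at this
    linarith
  have h2 : 1 + ‖w‖ ≤ 2 * (1 + ‖z‖) := by
    have := norm_le_norm_add_norm_sub z w
    linarith
  rcases le_total 0 s with hs | hs
  · rw [abs_of_nonneg hs, ← Real.mul_rpow zero_le_two (by positivity)]
    exact Real.rpow_le_rpow (by positivity) h1 hs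
  · rw [abs_of_nonpos hs]
    have h3 : (1 + ‖w‖) ^ (-s) ≤ 2 ^ (-s) * (1 + ‖z‖) ^ (-s) := by
      rw [← Real.mul_rpow zero_le_two (by positivity)]
      exact Real.rpow_le_rpow (by positivity) h2 (by linarith)
    rw [Real.rpow_neg (by positivity : (0 : ℝ) ≤ 1 + ‖w‖),
      Real.rpow_neg (by positivity : (0 : ℝ) ≤ 1 + ‖z‖), ← div_eq_mul_inv,
      inv_le_iff_one_le_mul₀ (by positivity), div_mul_eq_mul_div, one_le_div (by positivity)] at h3
    exact h3

/-- The local bound, with the Gaussian weight. -/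
theorem exists_wMod_le_eLpNorm_ball {n : ℕ} (hn : 0 < n) {p : ℝ≥0∞} (hp : 0 < p) (s : ℝ) :
    ∃ C : ℝ≥0, ∀ g : CSpace n → ℂ, Differentiable ℂ g → ∀ w,
      ENNReal.ofReal (wMod s g w) ≤
        C * eLpNorm (wMod s g) p (volume.restrict (Metric.ball w 1)) := by
  obtain ⟨C, hC⟩ := exists_enorm_le_eLpNorm_ball hn hp
  refine ⟨C * (Real.exp (1 / 2) * 2 ^ |s|).toNNReal, fun g hg w => ?_⟩
  -- The holomorphic factor recentres the Gaussian: `|F(u)| = |g(u)| e^{-|u|²/2} · e^{|w|²/2}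
  -- e^{|u-w|²/2}`, whose last factor is at most `e^{1/2}` on the unit ball.
  set F : CSpace n → ℂ := fun u => g u * Complex.exp (-inner ℂ w (u - w)) with hF
  have hFd : Differentiable ℂ F := by
    refine hg.mul (Differentiable.cexp (Differentiable.neg ?_))
    exact (innerSL ℂ w).differentiable.comp (by fun_prop)
  have hFu : ∀ u, ‖F u‖ = ‖g u‖ * Real.exp (-‖u‖ ^ 2 / 2) *
      (Real.exp (‖w‖ ^ 2 / 2) * Real.exp (‖u - w‖ ^ 2 / 2)) := by
    intro u
    rw [hF, norm_mul, Complex.norm_exp, ← Real.exp_add, mul_assoc, ← Real.exp_add]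
    congr 2
    have h1 : ‖u‖ ^ 2 = ‖w‖ ^ 2 + 2 * (inner ℂ w (u - w)).re + ‖u - w‖ ^ 2 := by
      have := norm_add_sq (𝕜 := ℂ) w (u - w)
      rw [add_sub_cancel] at this
      exact this
    rw [Complex.neg_re, h1]
    ring
  have hFw : ‖F w‖ = ‖g w‖ := by simp [hF]
  set A : ℝ := Real.exp (1 / 2) * 2 ^ |s| with hA
  set E : ℝ := Real.exp (‖w‖ ^ 2 / 2) * (1 + ‖w‖) ^ (-s) with hE
  have hE0 : 0 < E := by positivity
  have hA0 : 0 < A := by positivity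
  have hbd : ∀ u ∈ Metric.ball w 1, ‖F u‖ ≤ (A * E) * ‖wMod s g u‖ := by
    intro u hu
    rw [mem_ball_iff_norm] at hu
    rw [hFu, Real.norm_of_nonneg (wMod_nonneg s g u), wMod]
    have h1 : ‖u - w‖ ^ 2 / 2 ≤ 1 / 2 := by nlinarith [norm_nonneg (u - w)]
    have h2 := one_add_norm_rpow_le (-s) hu.le
    rw [abs_neg] at h2
    have h3 : 1 ≤ 2 ^ |s| * (1 + ‖w‖) ^ (-s) * (1 + ‖u‖) ^ s := by
      rw [Real.rpow_neg (by positivity), inv_le_iff_one_le_mul₀ (by positivity)] at h2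
      exact h2
    calc _ ≤ ‖g u‖ * Real.exp (-‖u‖ ^ 2 / 2) * (Real.exp (‖w‖ ^ 2 / 2) * Real.exp (1 / 2)) * 1 := by
          rw [mul_one]
          gcongr
      _ ≤ ‖g u‖ * Real.exp (-‖u‖ ^ 2 / 2) * (Real.exp (‖w‖ ^ 2 / 2) * Real.exp (1 / 2)) *
          (2 ^ |s| * (1 + ‖w‖) ^ (-s) * (1 + ‖u‖) ^ s) := by gcongr
      _ = _ := by rw [hA, hE]; ring
  have h1 : eLpNorm F p (volume.restrict (Metric.ball w 1)) ≤
      ENNReal.ofReal (A * E) * eLpNorm (wMod s g) p (volume.restrict (Metric.ball w 1)) := by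
    refine eLpNorm_le_mul_eLpNorm_of_ae_le_mul ?_ p
    exact (ae_restrict_iff' measurableSet_ball).2 (Filter.Eventually.of_forall hbd)
  have hW : wMod s g w = E⁻¹ * ‖F w‖ := by
    rw [hFw, wMod, hE, Real.rpow_neg (by positivity), mul_inv, inv_inv, ← Real.exp_neg, neg_div]
    ring
  rw [hW, ENNReal.ofReal_mul (by positivity), ofReal_norm]
  calc _ ≤ ENNReal.ofReal E⁻¹ * (C * (ENNReal.ofReal (A * E) *
        eLpNorm (wMod s g) p (volume.restrict (Metric.ball w 1)))) := by
        gcongr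
        exact (hC F hFd w).trans (by gcongr)
    _ = (C * (ENNReal.ofReal E⁻¹ * ENNReal.ofReal (A * E))) *
        eLpNorm (wMod s g) p (volume.restrict (Metric.ball w 1)) := by ring
    _ = _ := by
        rw [← ENNReal.ofReal_mul (by positivity), ENNReal.coe_mul]
        congr 3
        field_simp

/-- Tonelli for the kernel `1_{|z-u|<r}`, which is symmetric in `z` and `u`. -/
theorem lintegral_lintegral_ball {n : ℕ} {g : CSpace n → ℝ≥0∞} (hg : Measurable g) (r : ℝ) :
    (Measurable fun z => ∫⁻ u in Metric.ball z r, g u) ∧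
    ∫⁻ z, ∫⁻ u in Metric.ball z r, g u = volume (Metric.ball (0 : CSpace n) r) * ∫⁻ u, g u := by
  set K : CSpace n → CSpace n → ℝ≥0∞ := fun z u => (Metric.ball z r).indicator g u with hK
  have hset : MeasurableSet {q : CSpace n × CSpace n | dist q.2 q.1 < r} :=
    (isOpen_lt (by fun_prop) continuous_const).measurableSet
  have hKm : Measurable (Function.uncurry K) := by
    have : Function.uncurry K =
        {q : CSpace n × CSpace n | dist q.2 q.1 < r}.indicator fun q => g q.2 := by
      ext q
      simp only [Function.uncurry, hK, Set.indicator, Metric.mem_ball, Set.mem_ofPred_eq]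
    rw [this]
    exact (hg.comp measurable_snd).indicator hset
  have h1 : ∀ z, ∫⁻ u in Metric.ball z r, g u = ∫⁻ u, K z u := fun z =>
    (lintegral_indicator measurableSet_ball g).symm
  simp_rw [h1]
  refine ⟨hKm.lintegral_prod_right', ?_⟩
  rw [lintegral_lintegral_swap hKm.aemeasurable, ← lintegral_const_mul _ hg]
  refine lintegral_congr fun u => ?_
  have h2 : (fun z => K z u) = (Metric.ball u r).indicator fun _ => g u := by
    ext z
    simp only [hK, Set.indicator, Metric.mem_ball, dist_comm]
  rw [h2, lintegral_indicator_const measurableSet_ball, Measure.addHaar_ball_center, mul_comm]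

/-- A function dominating the local suprema of the weighted modulus, with comparable `L^p` norm. -/
theorem exists_local_majorant {n : ℕ} (hn : 0 < n) {p : ℝ≥0∞} (hp : 0 < p) (s : ℝ) :
    ∃ C : ℝ≥0, ∀ g : CSpace n → ℂ, Differentiable ℂ g → wNorm p s g ≠ ∞ →
      ∃ M : CSpace n → ℝ, Measurable M ∧ (∀ z, ∀ w ∈ Metric.closedBall z 1, wMod s g w ≤ M z) ∧
        (∀ z, M z ≤ C * (wNorm p s g).toReal) ∧ eLpNorm M p volume ≤ C * wNorm p s g := by
  obtain ⟨C, hC⟩ := exists_wMod_le_eLpNorm_ball hn hp s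
  have hsup : ∀ g : CSpace n → ℂ, ∀ z, eLpNorm (wMod s g) p (volume.restrict (Metric.ball z 2)) ≤
      wNorm p s g := fun g z => eLpNorm_mono_measure _ Measure.restrict_le_self
  have hloc : ∀ g : CSpace n → ℂ, Differentiable ℂ g → ∀ z, ∀ w ∈ Metric.closedBall z 1,
      ENNReal.ofReal (wMod s g w) ≤
        C * eLpNorm (wMod s g) p (volume.restrict (Metric.ball z 2)) := by
    intro g hg z w hw
    refine (hC g hg w).trans (mul_le_mul_right ?_ _)
    rw [Metric.mem_closedBall] at hw
    have hsub : Metric.ball w 1 ⊆ Metric.ball z 2 := Metric.ball_subset_ball' (by linarith)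
    exact eLpNorm_mono_measure _ (Measure.restrict_mono hsub le_rfl)
  by_cases hpt : p = ∞
  · subst hpt
    refine ⟨C, fun g hg hfin => ⟨fun _ => C * (wNorm ∞ s g).toReal, measurable_const, ?_,
      fun _ => le_rfl, ?_⟩⟩
    · intro z w hw
      have h1 := (hloc g hg z w hw).trans (mul_le_mul_right (hsup g z) _)
      have h2 := ENNReal.toReal_mono (ENNReal.mul_ne_top ENNReal.coe_ne_top hfin) h1
      rwa [ENNReal.toReal_ofReal (wMod_nonneg s g w), ENNReal.toReal_mul,
        ENNReal.coe_toReal] at h2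
    · rw [eLpNorm_exponent_top]
      refine eLpNormEssSup_le_of_ae_enorm_bound (Filter.Eventually.of_forall fun z => ?_)
      rw [Real.enorm_eq_ofReal (by positivity), ENNReal.ofReal_mul C.coe_nonneg,
        ENNReal.ofReal_toReal hfin, ENNReal.ofReal_coe_nnreal]
  have hq : 0 < p.toReal := ENNReal.toReal_pos hp.ne' hpt
  set v := volume (Metric.ball (0 : CSpace n) 2)
  have hvt : v ≠ ∞ := measure_ball_lt_top.ne
  set V : ℝ≥0 := (v ^ (1 / p.toReal)).toNNReal with hVdef
  have hV : (V : ℝ≥0∞) = v ^ (1 / p.toReal) :=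
    ENNReal.coe_toNNReal (ENNReal.rpow_ne_top_of_nonneg (by positivity) hvt)
  -- The `1` serves the uniform bound on `M`; `V` is the volume factor that Tonelli produces in its
  -- `L^p` norm.
  refine ⟨C * (1 + V), fun g hg hfin => ?_⟩
  have hm : Measurable fun u => ‖wMod s g u‖ₑ ^ p.toReal :=
    ((continuous_wMod s hg.continuous).measurable.enorm).pow_const _
  obtain ⟨hm1, hint⟩ := lintegral_lintegral_ball hm 2
  have heq : ∀ z, eLpNorm (wMod s g) p (volume.restrict (Metric.ball z 2)) =
      (∫⁻ u in Metric.ball z 2, ‖wMod s g u‖ₑ ^ p.toReal) ^ (1 / p.toReal) := fun z =>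
    eLpNorm_eq_lintegral_rpow_enorm_toReal hp.ne' hpt
  have hfz : ∀ z, C * eLpNorm (wMod s g) p (volume.restrict (Metric.ball z 2)) ≠ ∞ := fun z =>
    ENNReal.mul_ne_top ENNReal.coe_ne_top (ne_top_of_le_ne_top hfin (hsup g z))
  -- Radius 2 makes the ball contain the unit ball about every `w` with `|w-z| ≤ 1`.
  refine ⟨fun z => (C * eLpNorm (wMod s g) p (volume.restrict (Metric.ball z 2))).toReal,
    ?_, ?_, ?_, ?_⟩
  · simp_rw [heq]
    exact ((hm1.pow_const _).const_mul _).ennreal_toReal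
  · intro z w hw
    rw [← ENNReal.ofReal_le_iff_le_toReal (hfz z)]
    exact hloc g hg z w hw
  · intro z
    have h1 := ENNReal.toReal_mono (ENNReal.mul_ne_top ENNReal.coe_ne_top hfin)
      (mul_le_mul_right (hsup g z) (C : ℝ≥0∞))
    refine h1.trans ?_
    rw [ENNReal.toReal_mul, ENNReal.coe_toReal]
    gcongr
    nlinarith [C.coe_nonneg, V.coe_nonneg, mul_nonneg C.coe_nonneg V.coe_nonneg]
  · rw [eLpNorm_eq_lintegral_rpow_enorm_toReal hp.ne' hpt]
    have h1 : ∀ z, ‖(C * eLpNorm (wMod s g) p (volume.restrict (Metric.ball z 2))).toReal‖ₑ ^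
        p.toReal = (C : ℝ≥0∞) ^ p.toReal * ∫⁻ u in Metric.ball z 2, ‖wMod s g u‖ₑ ^ p.toReal := by
      intro z
      rw [Real.enorm_eq_ofReal ENNReal.toReal_nonneg, ENNReal.ofReal_toReal (hfz z),
        ENNReal.mul_rpow_of_nonneg _ _ hq.le, heq, ← ENNReal.rpow_mul,
        one_div_mul_cancel hq.ne', ENNReal.rpow_one]
    simp_rw [h1]
    rw [lintegral_const_mul _ hm1, hint, ENNReal.mul_rpow_of_nonneg _ _ (by positivity),
      ENNReal.mul_rpow_of_nonneg _ _ (by positivity), ← ENNReal.rpow_mul,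
      mul_one_div_cancel hq.ne', ENNReal.rpow_one, ← hV,
      ← eLpNorm_eq_lintegral_rpow_enorm_toReal hp.ne' hpt, ← mul_assoc, ← ENNReal.coe_mul]
    change _ ≤ _ * eLpNorm (wMod s g) p volume
    gcongr
    exact le_add_self

/-- Cauchy's estimate at radius `r = 1/(1+|z|)`: there `|y|² ≤ |z|² + 3`, so the Gaussian changes by
at most `e^{3/2}`, and the loss is `1/r = 1+|z|`. -/
theorem exists_wNorm_partialD_le {n : ℕ} (hn : 0 < n) {p : ℝ≥0∞} (hp : 0 < p) (s : ℝ) :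
    ∃ C : ℝ≥0, ∀ f : CSpace n → ℂ, Differentiable ℂ f → ∀ j,
      wNorm p s (partialD j f) ≤ C * wNorm p (s + 1) f := by
  obtain ⟨C, hC⟩ := exists_local_majorant hn hp (s + 1)
  set A : ℝ := Real.exp (3 / 2) * 2 ^ |s + 1| with hA
  have hA0 : 0 < A := by positivity
  -- Adding 1 keeps the constant nonzero, so that the case of infinite norm is trivial.
  refine ⟨A.toNNReal * (C + 1), fun f hf j => ?_⟩
  by_cases hfin : wNorm p (s + 1) f = ∞
  · rw [hfin, ENNReal.mul_top]
    · exact le_top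
    · rw [ENNReal.coe_ne_zero]
      exact mul_ne_zero (by simpa using hA0) (by positivity)
  obtain ⟨M, -, hM, -, hMn⟩ := hC f hf hfin
  have hpt : ∀ z, ‖wMod s (partialD j f) z‖ ≤ A * ‖M z‖ := by
    intro z
    have hM0 : 0 ≤ M z := (wMod_nonneg _ f z).trans (hM z z (by simp))
    rw [Real.norm_of_nonneg (wMod_nonneg _ _ z), Real.norm_of_nonneg hM0]
    have hz := norm_nonneg z
    set r : ℝ := (1 + ‖z‖)⁻¹ with hr
    have hr0 : 0 < r := by positivity
    have hr1 : r ≤ 1 := inv_le_one_of_one_le₀ (by linarith)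
    have hzr : (1 + ‖z‖) * r = 1 := mul_inv_cancel₀ (by positivity)
    have hbd : ∀ y ∈ Metric.closedBall z (r * ‖(EuclideanSpace.single j 1 : CSpace n)‖),
        ‖f y‖ ≤ A * M z * (Real.exp (‖z‖ ^ 2 / 2) * (1 + ‖z‖) ^ (-(s + 1))) := by
      intro y hy
      have hyr : ‖y - z‖ ≤ r := by
        rw [← dist_eq_norm]
        simpa using hy
      have h1 := hM z y (by rw [mem_closedBall_iff_norm]; linarith)
      have h2 := one_add_norm_rpow_le (-(s + 1)) (hyr.trans hr1)
      rw [abs_neg] at h2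
      have h3 : ‖y‖ ≤ ‖z‖ + r := by
        have := norm_le_norm_add_norm_sub z y
        rw [norm_sub_rev] at this
        linarith
      have h4 : ‖y‖ ^ 2 / 2 ≤ 3 / 2 + ‖z‖ ^ 2 / 2 := by
        nlinarith [norm_nonneg y]
      have h5 : ‖f y‖ = wMod (s + 1) f y * Real.exp (‖y‖ ^ 2 / 2) * (1 + ‖y‖) ^ (-(s + 1)) := by
        rw [wMod, neg_div, Real.exp_neg, Real.rpow_neg (by positivity)]
        have : (0 : ℝ) < (1 + ‖y‖) ^ (s + 1) := by positivity
        field_simp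
      calc ‖f y‖ ≤ M z * Real.exp (3 / 2 + ‖z‖ ^ 2 / 2) *
            (2 ^ |s + 1| * (1 + ‖z‖) ^ (-(s + 1))) := by
            rw [h5]
            gcongr
        _ = _ := by
            rw [Real.exp_add, hA]
            ring
    have h6 := norm_fderiv_apply_le hf hr0 hbd
    have h7 : (A * M z * (Real.exp (‖z‖ ^ 2 / 2) * (1 + ‖z‖) ^ (-(s + 1)))) / r *
        Real.exp (-‖z‖ ^ 2 / 2) * (1 + ‖z‖) ^ s = A * M z := by
      rw [neg_div, Real.exp_neg, Real.rpow_neg (by positivity), Real.rpow_add_one (by positivity),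
        hr]
      have : (0 : ℝ) < (1 + ‖z‖) ^ s := by positivity
      field_simp
    rw [← h7, wMod]
    gcongr
    exact h6
  refine (eLpNorm_le_mul_eLpNorm_of_ae_le_mul (Filter.Eventually.of_forall hpt) p).trans ?_
  rw [ENNReal.coe_mul, mul_assoc]
  refine mul_le_mul_right (hMn.trans ?_) _
  gcongr
  exact le_self_add

theorem exists_wNorm_partialD_iterate_le {n : ℕ} (hn : 0 < n) {p : ℝ≥0∞} (hp : 0 < p) (k : ℕ)
    (s : ℝ) : ∃ C : ℝ≥0, ∀ f : CSpace n → ℂ, Differentiable ℂ f → ∀ j,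
      wNorm p s ((partialD j)^[k] f) ≤ C * wNorm p (s + k) f := by
  induction k generalizing s with
  | zero => exact ⟨1, fun f _ j => by simp⟩
  | succ k ih =>
    obtain ⟨C₁, h₁⟩ := exists_wNorm_partialD_le hn hp s
    obtain ⟨C₂, h₂⟩ := ih (s + 1)
    refine ⟨C₁ * C₂, fun f hf j => ?_⟩
    rw [Function.iterate_succ_apply', ENNReal.coe_mul, mul_assoc]
    have : s + (k + 1 : ℕ) = s + 1 + k := by push_cast; ring
    rw [this]
    exact (h₁ _ (differentiable_partialD_iterate hf j k) j).trans (mul_le_mul_right (h₂ f hf j) _)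

theorem exists_wNorm_multiD_le {n : ℕ} (hn : 0 < n) {p : ℝ≥0∞} (hp : 0 < p) (γ : Fin n → ℕ)
    (s : ℝ) : ∃ C : ℝ≥0, ∀ f : CSpace n → ℂ, Differentiable ℂ f →
      wNorm p s (multiD γ f) ≤ C * wNorm p (s + (∑ j, γ j : ℕ)) f := by
  have key : ∀ (l : List (Fin n)) (s : ℝ), ∃ C : ℝ≥0, ∀ f : CSpace n → ℂ, Differentiable ℂ f →
      wNorm p s (listD l γ f) ≤ C * wNorm p (s + ((l.map γ).sum : ℕ)) f := by
    intro l
    induction l with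
    | nil => exact fun s => ⟨1, fun f _ => by simp [listD]⟩
    | cons j l ih =>
      intro s
      obtain ⟨C₁, h₁⟩ := exists_wNorm_partialD_iterate_le hn hp (γ j) s
      obtain ⟨C₂, h₂⟩ := ih (s + γ j)
      refine ⟨C₁ * C₂, fun f hf => ?_⟩
      rw [ENNReal.coe_mul, mul_assoc, List.map_cons, List.sum_cons, Nat.cast_add, ← add_assoc]
      exact (h₁ _ (differentiable_listD hf l γ) j).trans (mul_le_mul_right (h₂ f hf) _)
  have := key (List.finRange n) s
  rwa [← List.ofFn_eq_map, List.sum_ofFn] at this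

theorem wNorm_mono {n : ℕ} (p : ℝ≥0∞) {s t : ℝ} (h : s ≤ t) (f : CSpace n → ℂ) :
    wNorm p s f ≤ wNorm p t f := by
  refine eLpNorm_mono_real fun z => ?_
  rw [Real.norm_of_nonneg (wMod_nonneg s f z), wMod, wMod]
  have := norm_nonneg z
  gcongr
  linarith

/-! ### Inversion of the Euler operators -/

/-- This function carries the contribution of the points `tz` far from `z` when `R+a` is inverted.
-/
theorem memLp_one_add_norm_rpow_mul_exp (n : ℕ) {p : ℝ≥0∞} (hp : 0 < p) (c : ℝ) :
    MemLp (fun z : CSpace n => (1 + ‖z‖) ^ c * Real.exp (-‖z‖ / 2)) p volume := by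
  have hdecay : ∀ b : ℝ, ∃ B : ℝ, ∀ z : CSpace n, (1 + ‖z‖) ^ c * Real.exp (-‖z‖ / 2) ≤
      B * (1 + ‖z‖) ^ (-b) := by
    intro b
    set N := ⌈c + b⌉₊
    refine ⟨N.factorial * 2 ^ N * Real.exp (1 / 2), fun z => ?_⟩
    have hz := norm_nonneg z
    have h1 := Real.pow_div_factorial_le_exp ((1 + ‖z‖) / 2) (by positivity) N
    have h2 : (1 + ‖z‖) ^ (c + b) ≤ (1 + ‖z‖) ^ N := by
      rw [← Real.rpow_natCast]
      exact Real.rpow_le_rpow_of_exponent_le (by linarith) (Nat.le_ceil _)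
    have h3 : (1 + ‖z‖) ^ c = (1 + ‖z‖) ^ (c + b) * (1 + ‖z‖) ^ (-b) := by
      rw [← Real.rpow_add (by positivity)]
      congr 1
      ring
    have h4 : (1 + ‖z‖) ^ N ≤ N.factorial * 2 ^ N * Real.exp ((1 + ‖z‖) / 2) := by
      rw [div_pow, div_div, div_le_iff₀ (by positivity)] at h1
      linarith
    calc (1 + ‖z‖) ^ c * Real.exp (-‖z‖ / 2) =
          (1 + ‖z‖) ^ (c + b) * Real.exp (-‖z‖ / 2) * (1 + ‖z‖) ^ (-b) := by rw [h3]; ring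
      _ ≤ (N.factorial * 2 ^ N * Real.exp ((1 + ‖z‖) / 2)) * Real.exp (-‖z‖ / 2) *
          (1 + ‖z‖) ^ (-b) := by
          gcongr
          exact h2.trans h4
      _ = _ := by
          rw [mul_assoc _ (Real.exp _) (Real.exp _), ← Real.exp_add]
          congr 4
          ring
  have hcont : ∀ b : ℝ, Continuous fun z : CSpace n => (1 + ‖z‖) ^ b := fun b =>
    Continuous.rpow_const (by fun_prop) fun z => Or.inl (by positivity)
  have hmeas : AEStronglyMeasurable
      (fun z : CSpace n => (1 + ‖z‖) ^ c * Real.exp (-‖z‖ / 2)) volume :=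
    ((hcont c).mul (by fun_prop)).aestronglyMeasurable
  by_cases hpt : p = ∞
  · subst hpt
    obtain ⟨B, hB⟩ := hdecay 0
    refine memLp_top_of_bound hmeas B (Filter.Eventually.of_forall fun z => ?_)
    rw [Real.norm_of_nonneg (by positivity)]
    simpa using hB z
  have hq : 0 < p.toReal := ENNReal.toReal_pos hp.ne' hpt
  set Q : ℝ := Module.finrank ℝ (CSpace n) + 1
  obtain ⟨B, hB⟩ := hdecay (Q / p.toReal)
  have h1 : MemLp (fun z : CSpace n => (1 + ‖z‖) ^ (-(Q / p.toReal))) p volume := by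
    rw [← integrable_norm_rpow_iff (hcont _).aestronglyMeasurable hp.ne' hpt]
    have h2 : Integrable (fun z : CSpace n => (1 + ‖z‖) ^ (-Q)) volume :=
      integrable_one_add_norm (by simp [Q])
    refine h2.congr (Filter.Eventually.of_forall fun z => ?_)
    dsimp only
    rw [Real.norm_of_nonneg (by positivity), ← Real.rpow_mul (by positivity)]
    congr 1
    field_simp
  refine h1.of_le_mul (c := B) hmeas (Filter.Eventually.of_forall fun z => ?_)
  rw [Real.norm_of_nonneg (by positivity), Real.norm_of_nonneg (by positivity)]
  exact hB z

/-- The factor `t^a` turns `R+a` into `d/dt` along rays; this is the inversion formula for `R+a` in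
differential form. -/
theorem hasDerivAt_pow_mul_comp_ray {n : ℕ} {f : CSpace n → ℂ} (hf : Differentiable ℂ f) {a : ℕ}
    (ha : 0 < a) (z : CSpace n) (t : ℝ) :
    HasDerivAt (fun t : ℝ => (t : ℂ) ^ a * f ((t : ℂ) • z))
      ((t : ℂ) ^ (a - 1) * eulerD a f ((t : ℂ) • z)) t := by
  have h := ((hasDerivAt_pow a (t : ℂ)).mul (deriv_comp_ray hf z t)).comp_ofReal
  refine h.congr_deriv ?_
  obtain ⟨b, rfl⟩ := Nat.exists_eq_add_of_le' ha
  have : ∑ j, (((t : ℂ) • z) j) * partialD j f ((t : ℂ) • z) =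
      t * ∑ j, z j * partialD j f ((t : ℂ) • z) := by
    rw [Finset.mul_sum]
    exact Finset.sum_congr rfl fun j _ => by simp [mul_assoc]
  rw [eulerD, this]
  simp only [Nat.add_sub_cancel]
  ring

/-- Split the segment by the distance `(1-t)|z|` from `tz` to `z`. If it is at most 1, the local
majorant applies, with Gaussian gain `e^{-(1-t)|z|²/2}`. Otherwise the uniform bound `K` applies and
the gain is at least `e^{-|z|/2}`, which absorbs the polynomial loss in the weight. -/
theorem norm_eulerD_comp_ray_le {n : ℕ} {h : CSpace n → ℂ} {s K : ℝ} {M : CSpace n → ℝ}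
    (hM : ∀ z, ∀ w ∈ Metric.closedBall z 1, wMod s h w ≤ M z) (hK : ∀ z, M z ≤ K)
    (z : CSpace n) {t : ℝ} (ht : t ∈ Set.Ico (0 : ℝ) 1) :
    ‖h ((t : ℂ) • z)‖ ≤ Real.exp (‖z‖ ^ 2 / 2) * (1 + ‖z‖) ^ (-s) *
      (Real.exp (1 / 2) * 2 ^ |s| * M z * Real.exp (-((1 - t) * ((1 + ‖z‖ ^ 2) / 2))) +
        K * ((1 + ‖z‖) ^ (2 * |s|) * Real.exp (-‖z‖ / 2))) := by
  obtain ⟨ht0, ht1⟩ := ht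
  have hz := norm_nonneg z
  have hM0 : 0 ≤ M z := (wMod_nonneg s h z).trans (hM z z (by simp))
  have hK0 : 0 ≤ K := hM0.trans (hK z)
  set w : CSpace n := (t : ℂ) • z with hw
  have hwn : ‖w‖ = t * ‖z‖ := by simp [hw, norm_smul, abs_of_nonneg ht0]
  have hwz : ‖w - z‖ = (1 - t) * ‖z‖ := by
    have : w - z = ((t - 1 : ℝ) : ℂ) • z := by simp [hw, sub_smul]
    rw [this, norm_smul, Complex.norm_real, Real.norm_eq_abs, abs_of_nonpos (by linarith)]
    ring
  have h5 : ‖h w‖ = wMod s h w * Real.exp (‖w‖ ^ 2 / 2) * (1 + ‖w‖) ^ (-s) := by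
    rw [wMod, neg_div, Real.exp_neg, Real.rpow_neg (by positivity)]
    have : (0 : ℝ) < (1 + ‖w‖) ^ s := by positivity
    field_simp
  have hexp : ‖w‖ ^ 2 / 2 ≤ ‖z‖ ^ 2 / 2 - (1 - t) * (‖z‖ ^ 2 / 2) := by
    rw [hwn]
    nlinarith [mul_nonneg (mul_nonneg ht0 (sub_nonneg.2 ht1.le)) (sq_nonneg ‖z‖)]
  rw [h5, mul_add]
  by_cases hc : (1 - t) * ‖z‖ ≤ 1
  · refine le_add_of_le_of_nonneg ?_ (by positivity)
    have h1 := hM z w (by rw [mem_closedBall_iff_norm, hwz]; exact hc)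
    have h2 := one_add_norm_rpow_le (-s) (z := w) (w := z) (by rw [hwz]; exact hc)
    rw [abs_neg] at h2
    -- The extra `1/2` pays for replacing `|z|²` by `1+|z|²`, which keeps the decay rate positive at
    -- `z = 0`.
    have h3 : ‖w‖ ^ 2 / 2 ≤ ‖z‖ ^ 2 / 2 + 1 / 2 + -((1 - t) * ((1 + ‖z‖ ^ 2) / 2)) := by
      linarith
    calc _ ≤ M z * Real.exp (‖z‖ ^ 2 / 2 + 1 / 2 + -((1 - t) * ((1 + ‖z‖ ^ 2) / 2))) *
          (2 ^ |s| * (1 + ‖z‖) ^ (-s)) := by gcongr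
      _ = _ := by
        rw [Real.exp_add, Real.exp_add]
        ring
  · refine le_add_of_nonneg_of_le (by positivity) ?_
    have h1 := (hM w w (by simp)).trans (hK w)
    have h2 : (1 + ‖w‖) ^ (-s) ≤ (1 + ‖z‖) ^ (-s) * (1 + ‖z‖) ^ (2 * |s|) := by
      have hwle : ‖w‖ ≤ ‖z‖ := by rw [hwn]; nlinarith
      have hw0 := norm_nonneg w
      calc (1 + ‖w‖) ^ (-s) ≤ (1 + ‖w‖) ^ |s| :=
            Real.rpow_le_rpow_of_exponent_le (by linarith) (neg_le_abs s)
        _ ≤ (1 + ‖z‖) ^ |s| := by gcongr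
        _ ≤ (1 + ‖z‖) ^ (-s + 2 * |s|) :=
            Real.rpow_le_rpow_of_exponent_le (by linarith) (by linarith [le_abs_self s])
        _ = _ := Real.rpow_add (by positivity) _ _
    have h3 : ‖w‖ ^ 2 / 2 ≤ ‖z‖ ^ 2 / 2 + -‖z‖ / 2 := by
      push Not at hc
      nlinarith
    calc _ ≤ K * Real.exp (‖z‖ ^ 2 / 2 + -‖z‖ / 2) *
          ((1 + ‖z‖) ^ (-s) * (1 + ‖z‖) ^ (2 * |s|)) := by gcongr
      _ = _ := by
        rw [Real.exp_add]
        ring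

/-- The gain of two powers is `∫_0^1 e^{-(1-t)b} dt ≤ 1/b` with `b = (1+|z|²)/2`, together with
`(1+|z|)² ≤ 4b`. -/
theorem wMod_le_of_eulerD {n : ℕ} {f : CSpace n → ℂ} (hf : Differentiable ℂ f) {a : ℕ}
    (ha : 0 < a) {s K : ℝ} {M : CSpace n → ℝ}
    (hM : ∀ z, ∀ w ∈ Metric.closedBall z 1, wMod s (eulerD a f) w ≤ M z) (hK : ∀ z, M z ≤ K)
    (z : CSpace n) :
    wMod (s + 2) f z ≤ 4 * (Real.exp (1 / 2) * 2 ^ |s|) * M z +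
      K * ((1 + ‖z‖) ^ (2 * |s| + 2) * Real.exp (-‖z‖ / 2)) := by
  have hz := norm_nonneg z
  have hM0 : 0 ≤ M z := (wMod_nonneg s _ z).trans (hM z z (by simp))
  set A : ℝ := Real.exp (1 / 2) * 2 ^ |s|
  set D : ℝ := K * ((1 + ‖z‖) ^ (2 * |s|) * Real.exp (-‖z‖ / 2)) with hD
  set E : ℝ := Real.exp (‖z‖ ^ 2 / 2) * (1 + ‖z‖) ^ (-s) with hE
  set b : ℝ := (1 + ‖z‖ ^ 2) / 2 with hb
  have hb0 : 0 < b := by positivity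
  have hA0 : 0 < A := by positivity
  have hE0 : 0 < E := by positivity
  have hB : ∀ t : ℝ, HasDerivAt
      (fun t : ℝ => E * (A * M z * ((Real.exp (-((1 - t) * b)) - Real.exp (-b)) / b) + D * t))
      (E * (A * M z * Real.exp (-((1 - t) * b)) + D)) t := by
    intro t
    have h1 : HasDerivAt (fun t : ℝ => -((1 - t) * b)) b t := by
      exact (((hasDerivAt_id t).const_sub 1).mul_const b).neg.congr_deriv (by ring)
    have h2 := (((h1.exp.sub_const (Real.exp (-b))).div_const b).const_mul (A * M z)).add
      ((hasDerivAt_id t).const_mul D)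
    refine (h2.const_mul E).congr_deriv ?_
    field_simp
  have hu := fun t => hasDerivAt_pow_mul_comp_ray hf ha z t
  -- A comparison of derivatives replaces integration: `B` is the explicit primitive of the bound,
  -- and both sides vanish at `t = 0` because `a > 0`.
  have hmain := image_norm_le_of_norm_deriv_right_le_deriv_boundary (a := 0) (b := 1)
    (f := fun t : ℝ => (t : ℂ) ^ a * f ((t : ℂ) • z))
    (fun t _ => (hu t).continuousAt.continuousWithinAt)
    (fun t _ => (hu t).hasDerivWithinAt)
    (B := fun t : ℝ => E * (A * M z * ((Real.exp (-((1 - t) * b)) - Real.exp (-b)) / b) + D * t))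
    (by simp [ha.ne']) hB
    (fun t ht => by
      rw [norm_mul]
      have h1 : ‖(t : ℂ) ^ (a - 1)‖ ≤ 1 := by
        rw [norm_pow, Complex.norm_real, Real.norm_of_nonneg ht.1]
        exact pow_le_one₀ ht.1 ht.2.le
      refine (mul_le_of_le_one_left (norm_nonneg _) h1).trans ?_
      exact norm_eulerD_comp_ray_le hM hK z ht)
    (show (1 : ℝ) ∈ Set.Icc (0 : ℝ) 1 by simp)
  simp only [Complex.ofReal_one, one_pow, one_smul, one_mul, sub_self, zero_mul, neg_zero,
    Real.exp_zero, mul_one] at hmain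
  have h3 : (1 - Real.exp (-b)) / b ≤ 1 / b := by
    gcongr
    linarith [Real.exp_pos (-b)]
  have h4 : ‖f z‖ ≤ E * (A * M z * (1 / b) + D) := hmain.trans (by gcongr)
  have h5 : (1 + ‖z‖) ^ 2 * (1 / b) ≤ 4 := by
    rw [mul_one_div, div_le_iff₀ hb0, hb]
    nlinarith [sq_nonneg (‖z‖ - 1)]
  have h6 : E * (Real.exp (-‖z‖ ^ 2 / 2) * (1 + ‖z‖) ^ (s + 2)) = (1 + ‖z‖) ^ 2 := by
    rw [hE, neg_div, Real.exp_neg, Real.rpow_neg (by positivity), Real.rpow_add (by positivity),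
      Real.rpow_two]
    have : (0 : ℝ) < (1 + ‖z‖) ^ s := by positivity
    field_simp
  calc wMod (s + 2) f z = ‖f z‖ * (Real.exp (-‖z‖ ^ 2 / 2) * (1 + ‖z‖) ^ (s + 2)) := by
        rw [wMod, mul_assoc]
    _ ≤ E * (A * M z * (1 / b) + D) * (Real.exp (-‖z‖ ^ 2 / 2) * (1 + ‖z‖) ^ (s + 2)) := by
        gcongr
    _ = (E * (Real.exp (-‖z‖ ^ 2 / 2) * (1 + ‖z‖) ^ (s + 2))) * (A * M z * (1 / b) + D) := by ring
    _ = (1 + ‖z‖) ^ 2 * (1 / b) * (A * M z) + (1 + ‖z‖) ^ 2 * D := by rw [h6]; ring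
    _ ≤ 4 * (A * M z) + (1 + ‖z‖) ^ 2 * D := by gcongr
    _ = _ := by
        rw [hD, Real.rpow_add (by positivity), Real.rpow_two]
        ring

/-- Take `L^p` norms in the pointwise bound: the majorant has comparable norm, and the far part is
`K`, itself a multiple of the norm of `(R+a)f`, times a fixed `L^p` function. -/
theorem exists_wNorm_le_eulerD {n : ℕ} (hn : 0 < n) {p : ℝ≥0∞} (hp : 0 < p) {a : ℕ} (ha : 0 < a)
    (s : ℝ) : ∃ C : ℝ≥0, ∀ f : CSpace n → ℂ, Differentiable ℂ f →
      wNorm p (s + 2) f ≤ C * wNorm p s (eulerD a f) := by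
  obtain ⟨C, hC⟩ := exists_local_majorant hn hp s
  set A : ℝ := Real.exp (1 / 2) * 2 ^ |s| with hA
  have hκ := memLp_one_add_norm_rpow_mul_exp n hp (2 * |s| + 2)
  set κ : CSpace n → ℝ := fun z => (1 + ‖z‖) ^ (2 * |s| + 2) * Real.exp (-‖z‖ / 2) with hκd
  have hL : ENNReal.LpAddConst p ≠ ∞ := (ENNReal.LpAddConst_lt_top p).ne
  -- `LpAddConst` accounts for the quasi-triangle inequality when `p < 1`; the `+ 1` makes `T`
  -- nonzero.
  set T : ℝ≥0∞ := ENNReal.LpAddConst p * (ENNReal.ofReal (4 * A) * C + C * eLpNorm κ p volume) + 1 with hT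
  have hTt : T ≠ ∞ := by
    refine ENNReal.add_ne_top.2 ⟨ENNReal.mul_ne_top hL (ENNReal.add_ne_top.2 ⟨?_, ?_⟩), by simp⟩
    · exact ENNReal.mul_ne_top ENNReal.ofReal_ne_top ENNReal.coe_ne_top
    · exact ENNReal.mul_ne_top ENNReal.coe_ne_top hκ.2.ne
  refine ⟨T.toNNReal, fun f hf => ?_⟩
  rw [ENNReal.coe_toNNReal hTt]
  by_cases hfin : wNorm p s (eulerD a f) = ∞
  · rw [hfin, ENNReal.mul_top (by simp [hT])]
    exact le_top
  obtain ⟨M, hMm, hM, hMK, hMn⟩ := hC _ (differentiable_eulerD hf a) hfin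
  set K : ℝ := C * (wNorm p s (eulerD a f)).toReal with hK
  have hK0 : 0 ≤ K := by positivity
  have h1 : wNorm p (s + 2) f ≤ eLpNorm ((fun z => 4 * A * M z) + fun z => K * κ z) p volume := by
    refine eLpNorm_mono_real fun z => ?_
    rw [Real.norm_of_nonneg (wMod_nonneg _ f z)]
    exact wMod_le_of_eulerD hf ha hM hMK z
  refine h1.trans ((eLpNorm_add_le' (hMm.const_mul _).aestronglyMeasurable
    (hκ.1.const_mul _) p).trans ?_)
  have h2 : eLpNorm (fun z => 4 * A * M z) p volume ≤
      ENNReal.ofReal (4 * A) * (C * wNorm p s (eulerD a f)) := by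
    refine (eLpNorm_le_mul_eLpNorm_of_ae_le_mul (Filter.Eventually.of_forall fun z => ?_) p).trans
      (mul_le_mul_right hMn _)
    rw [norm_mul, Real.norm_of_nonneg (by positivity)]
  have h3 : eLpNorm (fun z => K * κ z) p volume ≤
      C * wNorm p s (eulerD a f) * eLpNorm κ p volume := by
    have : (C : ℝ≥0∞) * wNorm p s (eulerD a f) = ENNReal.ofReal K := by
      rw [hK, ENNReal.ofReal_mul C.coe_nonneg, ENNReal.ofReal_toReal hfin,
        ENNReal.ofReal_coe_nnreal]
    rw [this]
    refine eLpNorm_le_mul_eLpNorm_of_ae_le_mul (Filter.Eventually.of_forall fun z => ?_) p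
    rw [norm_mul, Real.norm_of_nonneg hK0]
  calc _ ≤ ENNReal.LpAddConst p * (ENNReal.ofReal (4 * A) * (C * wNorm p s (eulerD a f)) +
        C * wNorm p s (eulerD a f) * eLpNorm κ p volume) := by gcongr
    _ = (ENNReal.LpAddConst p * (ENNReal.ofReal (4 * A) * C + C * eLpNorm κ p volume)) *
        wNorm p s (eulerD a f) := by ring
    _ ≤ _ := by
        gcongr
        exact le_self_add

theorem exists_wNorm_le_eulerProd {n : ℕ} (hn : 0 < n) {p : ℝ≥0∞} (hp : 0 < p) (m : ℕ) (s : ℝ) :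
    ∃ C : ℝ≥0, ∀ f : CSpace n → ℂ, Differentiable ℂ f →
      wNorm p (s + 2 * m) f ≤ C * wNorm p s (eulerProd m f) := by
  induction m with
  | zero => exact ⟨1, fun f _ => by simp [eulerProd]⟩
  | succ m ih =>
    obtain ⟨C₁, h₁⟩ := ih
    -- The shift `n + m` is positive even for `m = 0`, because `n > 0`.
    obtain ⟨C₂, h₂⟩ := exists_wNorm_le_eulerD hn hp (a := n + m) (by omega) (s + 2 * m)
    refine ⟨C₂ * C₁, fun f hf => ?_⟩
    have : s + 2 * (m + 1 : ℕ) = s + 2 * m + 2 := by push_cast; ring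
    rw [this, ENNReal.coe_mul, mul_assoc]
    exact (h₂ f hf).trans (mul_le_mul_right (h₁ _ (differentiable_eulerD hf _)) _)

/-! ### Comparison of the norms -/

/-- The exponent of `1 + |z|` in the weight of `L^p_α`. -/
def weightExp (p : ℝ≥0∞) (α : ℝ) : ℝ :=
  if p = ∞ then -α else -α / p.toReal

/-- For finite `p` the density `(1+|z|)^{-α}` moves inside the `p`-th power as exponent `-α/p`, and
the normalization of `dV` gives `c`. For `p = ∞` only null sets matter, so `c = 1`. -/
theorem exists_weightedNorm_eq (n : ℕ) {p : ℝ≥0∞} (hp : 0 < p) (α : ℝ) :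
    ∃ c : ℝ≥0, 0 < c ∧ ∀ ψ : CSpace n → ℂ,
      weightedNorm p α ψ = c * wNorm p (weightExp p α) ψ := by
  have hπ : (0 : ℝ) < (Real.pi ^ n)⁻¹ := by positivity
  by_cases hpt : p = ∞
  · subst hpt
    refine ⟨1, one_pos, fun ψ => ?_⟩
    have hc : ENNReal.ofReal (Real.pi ^ n)⁻¹ ≠ 0 := by simpa using hπ
    rw [weightedNorm, if_pos rfl, wNorm, eLpNorm_exponent_top, eLpNormEssSup, weightExp, if_pos rfl,
      volV, essSup, essSup, Measure.ae_ennreal_smul_measure_eq hc, ENNReal.coe_one, one_mul]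
    congr 1
    ext z
    rw [Real.enorm_eq_ofReal (wMod_nonneg _ _ _), wMod, Real.rpow_neg (by positivity), div_eq_mul_inv]
  have hq : 0 < p.toReal := ENNReal.toReal_pos hp.ne' hpt
  refine ⟨(Real.pi ^ n)⁻¹.toNNReal ^ (1 / p.toReal),
    NNReal.rpow_pos (by simpa using hπ), fun ψ => ?_⟩
  have hm : Measurable fun z : CSpace n => ENNReal.ofReal (1 / (1 + ‖z‖) ^ α) := by fun_prop
  rw [weightedNorm, if_neg hpt, volW,
    lintegral_withDensity_eq_lintegral_mul_non_measurable _ hm (by simp), volV,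
    lintegral_smul_measure, smul_eq_mul, ENNReal.mul_rpow_of_nonneg _ _ (by positivity), wNorm,
    eLpNorm_eq_lintegral_rpow_enorm_toReal hp.ne' hpt, ENNReal.coe_rpow_of_nonneg _ (by positivity)]
  congr 2
  refine lintegral_congr fun z => ?_
  rw [Real.enorm_eq_ofReal (wMod_nonneg _ _ _), wMod, weightExp, if_neg hpt,
    ENNReal.ofReal_mul (by positivity) (q := (1 + ‖z‖) ^ (-α / p.toReal)),
    ENNReal.mul_rpow_of_nonneg _ _ hq.le, Pi.mul_apply, mul_comm]
  congr 1
  rw [ENNReal.ofReal_rpow_of_nonneg (by positivity) hq.le, ← Real.rpow_mul (by positivity),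
    div_mul_cancel₀ _ hq.ne', Real.rpow_neg (by positivity), one_div]

theorem exists_eLpNorm_finset_sum_le {ι : Type*} {n : ℕ} (p : ℝ≥0∞) (s : Finset ι) :
    ∃ C : ℝ≥0, ∀ g : ι → CSpace n → ℝ, (∀ i, Continuous (g i)) →
      eLpNorm (fun z => ∑ i ∈ s, g i z) p volume ≤ C * ∑ i ∈ s, eLpNorm (g i) p volume := by
  classical
  induction s using Finset.induction_on with
  | empty => exact ⟨0, fun g _ => by simp⟩
  | insert j s hj ih =>
    obtain ⟨C, hC⟩ := ih
    have hL : ENNReal.LpAddConst p ≠ ∞ := (ENNReal.LpAddConst_lt_top p).ne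
    refine ⟨(ENNReal.LpAddConst p).toNNReal * (1 + C), fun g hg => ?_⟩
    simp only [Finset.sum_insert hj]
    have h1 := eLpNorm_add_le' (μ := (volume : Measure (CSpace n))) (hg j).aestronglyMeasurable
      (continuous_finsetSum s fun i _ => hg i).aestronglyMeasurable p
    refine h1.trans ?_
    rw [ENNReal.coe_mul, ENNReal.coe_toNNReal hL, mul_assoc]
    refine mul_le_mul_right ?_ _
    have h2 := hC g hg
    rw [ENNReal.coe_add, ENNReal.coe_one, add_mul, one_mul, mul_add]
    exact add_le_add le_self_add (h2.trans le_add_self)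

theorem norm_radialD_natCast {n : ℕ} (hn : 0 < n) (m : ℕ) {f : CSpace n → ℂ}
    (hf : Differentiable ℂ f) (z : CSpace n) :
    ‖radialD (m : ℝ) f z‖ = (1 + ‖z‖) ^ (-m : ℝ) * ‖eulerProd m f z‖ := by
  rw [radialD, fracD_natCast hn m hf, norm_mul, Complex.norm_real,
    Real.norm_of_nonneg (by positivity)]

theorem continuous_radialD_natCast {n : ℕ} (hn : 0 < n) (m : ℕ) {f : CSpace n → ℂ}
    (hf : Differentiable ℂ f) : Continuous (radialD (m : ℝ) f) := by
  unfold radialD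
  rw [fracD_natCast hn m hf]
  refine Continuous.mul (Complex.continuous_ofReal.comp ?_) (differentiable_eulerProd m hf).continuous
  exact Continuous.rpow_const (by fun_prop) fun z => Or.inl (by positivity)

theorem wNorm_radialD_natCast {n : ℕ} (hn : 0 < n) (p : ℝ≥0∞) (m : ℕ) (s : ℝ) {f : CSpace n → ℂ}
    (hf : Differentiable ℂ f) : wNorm p s (radialD (m : ℝ) f) = wNorm p (s - m) (eulerProd m f) := by
  unfold wNorm
  congr 1
  ext z
  rw [wMod, wMod, norm_radialD_natCast hn m hf, sub_eq_add_neg, Real.rpow_add (by positivity)]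
  ring

theorem exists_wNorm_radialD_le {n : ℕ} (hn : 0 < n) (p : ℝ≥0∞) (m : ℕ) (s : ℝ) :
    ∃ C : ℝ≥0, ∀ f : CSpace n → ℂ, Differentiable ℂ f →
      wNorm p s (radialD (m : ℝ) f) ≤ C * ∑ γ ∈ multiIndexLE n m, wNorm p s (multiD γ f) := by
  obtain ⟨A, hA0, hA⟩ := exists_norm_eulerProd_le n m
  obtain ⟨C, hC⟩ := exists_eLpNorm_finset_sum_le (n := n) p (multiIndexLE n m)
  refine ⟨A.toNNReal * C, fun f hf => ?_⟩
  have h1 := hC (fun γ => wMod s (multiD γ f)) fun γ =>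
    continuous_wMod s (differentiable_multiD hf γ).continuous
  rw [ENNReal.coe_mul, mul_assoc]
  refine (eLpNorm_le_mul_eLpNorm_of_ae_le_mul (Filter.Eventually.of_forall fun z => ?_) p).trans
    (mul_le_mul_right h1 _)
  rw [Real.norm_of_nonneg (wMod_nonneg _ _ _),
    Real.norm_of_nonneg (Finset.sum_nonneg fun γ _ => wMod_nonneg _ _ _), wMod,
    norm_radialD_natCast hn m hf]
  simp only [wMod, ← Finset.sum_mul]
  have h2 : (1 + ‖z‖) ^ (-m : ℝ) * ‖eulerProd m f z‖ ≤
      A * ∑ γ ∈ multiIndexLE n m, ‖multiD γ f z‖ := by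
    rw [Real.rpow_neg (by positivity), Real.rpow_natCast, inv_mul_le_iff₀ (by positivity)]
    refine (hA f hf z).trans (le_of_eq ?_)
    ring
  calc _ ≤ (A * ∑ γ ∈ multiIndexLE n m, ‖multiD γ f z‖) * Real.exp (-‖z‖ ^ 2 / 2) *
        (1 + ‖z‖) ^ s := by gcongr
    _ = _ := by ring

/-- The exponents balance: derivatives raise `s` to `s + |γ| ≤ s + m = (s - m) + 2m`, inverting the
Euler factors lowers this to `s - m`, and the weight in `radialD` accounts for the remaining `m`. -/
theorem exists_sum_wNorm_multiD_le {n : ℕ} (hn : 0 < n) {p : ℝ≥0∞} (hp : 0 < p) (m : ℕ) (s : ℝ) :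
    ∃ C : ℝ≥0, ∀ f : CSpace n → ℂ, Differentiable ℂ f →
      ∑ γ ∈ multiIndexLE n m, wNorm p s (multiD γ f) ≤ C * wNorm p s (radialD (m : ℝ) f) := by
  choose C hC using fun γ : Fin n → ℕ => exists_wNorm_multiD_le hn hp γ s
  obtain ⟨K, hK⟩ := exists_wNorm_le_eulerProd hn hp m (s - m)
  refine ⟨∑ γ ∈ multiIndexLE n m, C γ * K, fun f hf => ?_⟩
  rw [ENNReal.ofNNReal_finsetSum, Finset.sum_mul]
  refine Finset.sum_le_sum fun γ hγ => (hC γ f hf).trans ?_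
  rw [mem_multiIndexLE] at hγ
  rw [ENNReal.coe_mul, mul_assoc, wNorm_radialD_natCast hn p m s hf]
  refine mul_le_mul_right ((wNorm_mono p ?_ f).trans (hK f hf)) _
  have : ((∑ j, γ j : ℕ) : ℝ) ≤ m := by exact_mod_cast hγ
  linarith

theorem exists_norm_equiv {n : ℕ} (hn : 0 < n) {p : ℝ≥0∞} (hp : 0 < p) (α : ℝ) (m : ℕ) :
    ∃ C : ℝ≥0, 0 < C ∧ ∀ f : CSpace n → ℂ, Differentiable ℂ f →
      (C : ℝ≥0∞)⁻¹ * fockSobolevNorm p α (m : ℝ) f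
          ≤ ∑ γ ∈ multiIndexLE n m, weightedNorm p α (multiD γ f) ∧
      ∑ γ ∈ multiIndexLE n m, weightedNorm p α (multiD γ f)
          ≤ (C : ℝ≥0∞) * fockSobolevNorm p α (m : ℝ) f := by
  obtain ⟨c, -, hc⟩ := exists_weightedNorm_eq n hp α
  obtain ⟨A, hA⟩ := exists_wNorm_radialD_le hn p m (weightExp p α)
  obtain ⟨B, hB⟩ := exists_sum_wNorm_multiD_le hn hp m (weightExp p α)
  have hC0 : 0 < A + B + 1 := by positivity
  refine ⟨A + B + 1, hC0, fun f hf => ?_⟩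
  simp only [fockSobolevNorm, Nat.cast_nonneg, if_true, hc, ← Finset.mul_sum]
  have hAC : (A : ℝ≥0∞) ≤ (A + B + 1 : ℝ≥0) := by
    rw [ENNReal.coe_le_coe, add_assoc]
    exact le_self_add
  have hBC : (B : ℝ≥0∞) ≤ (A + B + 1 : ℝ≥0) := by
    rw [ENNReal.coe_le_coe, add_comm A, add_assoc]
    exact le_self_add
  constructor
  · rw [ENNReal.inv_mul_le_iff (by simp) ENNReal.coe_ne_top, mul_left_comm]
    exact mul_le_mul_right ((hA f hf).trans (mul_le_mul_left hAC _)) _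
  · rw [mul_left_comm]
    exact mul_le_mul_right ((hB f hf).trans (mul_le_mul_left hBC _)) _

end FockSobolev

end

theorem corollary4p4 (n : ℕ) (hn : 0 < n) (p : ℝ≥0∞) (hp : 0 < p) (α : ℝ)
    (m : ℕ) (hm : 0 < m) :
    (∃ C : ℝ≥0, 0 < C ∧ ∀ f : FockSobolev.CSpace n → ℂ, Differentiable ℂ f →
      (C : ℝ≥0∞)⁻¹ * FockSobolev.fockSobolevNorm p α (m : ℝ) f
          ≤ ∑ γ ∈ FockSobolev.multiIndexLE n m,
              FockSobolev.weightedNorm p α (FockSobolev.multiD γ f) ∧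
      ∑ γ ∈ FockSobolev.multiIndexLE n m, FockSobolev.weightedNorm p α (FockSobolev.multiD γ f)
          ≤ (C : ℝ≥0∞) * FockSobolev.fockSobolevNorm p α (m : ℝ) f) ∧
    FockSobolev.fockSobolev n p α (m : ℝ) =
      {f | Differentiable ℂ f ∧ ∀ γ : Fin n → ℕ, ∑ j, γ j ≤ m →
        FockSobolev.MemL p α (FockSobolev.multiD γ f)} := by
  have key := FockSobolev.exists_norm_equiv hn hp α m
  refine ⟨key, ?_⟩
  obtain ⟨C, hC0, hC⟩ := key
  have hnorm : ∀ f : FockSobolev.CSpace n → ℂ, FockSobolev.fockSobolevNorm p α (m : ℝ) f =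
      FockSobolev.weightedNorm p α (FockSobolev.radialD (m : ℝ) f) := fun f =>
    if_pos (Nat.cast_nonneg m)
  ext f
  constructor
  · rintro ⟨hf, -, hfin⟩
    refine ⟨hf, fun γ hγ =>
      ⟨(FockSobolev.differentiable_multiD hf γ).continuous.aestronglyMeasurable, ?_⟩⟩
    have h1 := (hC f hf).2.trans_lt
      (ENNReal.mul_lt_top ENNReal.coe_lt_top ((hnorm f).trans_lt hfin))
    exact ENNReal.sum_lt_top.1 h1 γ (FockSobolev.mem_multiIndexLE.2 hγ)
  · rintro ⟨hf, h⟩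
    refine ⟨hf, (FockSobolev.continuous_radialD_natCast hn m hf).aestronglyMeasurable, ?_⟩
    have h1 := (hC f hf).1.trans_lt
      (ENNReal.sum_lt_top.2 fun γ hγ => (h γ (FockSobolev.mem_multiIndexLE.1 hγ)).2)
    rw [hnorm] at h1
    exact (ENNReal.mul_lt_top_iff.1 h1).elim (fun h => h.2) fun h => h.elim
      (fun h => absurd h (ENNReal.inv_ne_zero.2 ENNReal.coe_ne_top)) fun h => h ▸ ENNReal.zero_lt_top
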